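/- Let $X(x)$, $x\in\mathbb R^2$, be a real-valued, zero-mean, mean-square continuous random field with finite third moments which is strictly homogeneous and strictly isotropic, i.e. all its finite-dimensional distributions are invariant under translations and under rotations $g\in SO(2)$. Assume moreover that its third-order cumulant $\mathrm{Cum}(X(x_1),X(x_2),X(x_3))$ is unchanged when $x_1,x_2,x_3$ are all reflected in the first coordinate axis. A bispectral density of $X$ is a function $S(\omega_1,\omega_2,\omega_3)$ on $\omega_1+\omega_2+\omega_3=0$ such that $(\omega_2,\omega_3)\mapsto S(-\omega_2-\omega_3,\omega_2,\omega_3)$ is integrable on $\mathbb R^2\times\mathbb R^2$ and, for all $x_1,x_2,x_3$, $$\mathrm{Cum}(X(x_1),X(x_2),X(x_3))=\iint e^{i(x_1\cdot\omega_1+x_2\cdot\omega_2+x_3\cdot\omega_3)}\,S(\omega_1,\omega_2,\omega_3)\,d\omega_2\,d\omega_3,\qquad \omega_1=-\omega_2-\omega_3 .$$ (1) There is a function $\mathcal C$ with $\mathrm{Cum}(X(x_1),X(x_2),X(x_3))=\mathcal C(|x_3-x_2|,|x_2-x_1|,|x_3-x_1|)$ for all $x_1,x_2,x_3$; that is, the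 third-order covariance depends only on the side lengths of the triangle. (2) Every bispectral density $S$ of $X$ is real and depends only on the wave numbers: there is a real function $S_3$ with $S(\omega_1,\omega_2,\omega_3)=S_3(|\omega_1|,|\omega_2|,|\omega_3|)$ for almost every $(\omega_2,\omega_3)$, where $\omega_1=-\omega_2-\omega_3$. (3) Let $\mathcal C$ be as in (1) and let $S_3$ be a real function such that $S_3(|\omega_1|,|\omega_2|,|\omega_3|)$ is a bispectral density of $X$. For $r_2,r_3,\rho_2,\rho_3\ge 0$ put $r_1^2=r_2^2+r_3^2-2r_2r_3\cos\varphi$, $\rho_1^2=\rho_2^2+\rho_3^2-2\rho_2\rho_3\cos\eta$ and $$w_\pm=\sqrt{(\rho_2r_2)^2+(\rho_3r_3)^2-2\rho_2r_2\rho_3r_3\cos(\eta\pm\varphi)} .$$ Let $J_\ell$ be the Bessel function of the first kind. Then for all $r_2,r_3\ge0$ and all $\varphi$ the following integral exists and $$\mathcal C(r_1,r_2,r_3)=2\pi\int_0^\infty\!\!\int_0^\infty\!\!\int_0^\pi\bigl(J_0(w_+)+J_0(w_-)\bigr)S_3(\rho_1,\rho_2,\rho_3)\,d\eta\,\rho_2d\rho_2\,\rho_3d\rho_3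 .$$ In turn, $$S_3(\rho_1,\rho_2,\rho_3)=\frac1{(2\pi)^3}\int_0^\infty\!\!\int_0^\infty\!\!\int_0^\pi\bigl(J_0(w_+)+J_0(w_-)\bigr)\mathcal C(r_1,r_2,r_3)\,d\varphi\,r_2dr_2\,r_3dr_3$$ for almost every $(\rho_2,\rho_3,\eta)\in(0,\infty)^2\times(0,\pi)$ at which this integral exists (absolutely); if $(\rho_2,\rho_3,\eta)\mapsto S_3(\rho_1,\rho_2,\rho_3)$ is continuous on $[0,\infty)^2\times[0,\pi]$, then for every point of $[0,\infty)^2\times[0,\pi]$ at which the integral exists. (4) Put $$\mathcal T=J_0(\rho_2r_2)J_0(\rho_3r_3)+2\sum_{\ell=1}^\infty\cos(\ell\varphi)J_\ell(\rho_2r_2)J_\ell(\rho_3r_3)\cos(\ell\eta).$$ The series converges, $\mathcal T=\tfrac12\bigl(J_0(w_+)+J_0(w_-)\bigr)$, and (3) holds equally in the form $$\mathcal C(r_1,r_2,r_3)=4\pi\int_0^\infty\!\!\int_0^\infty\!\!\int_0^\pi\mathcal T\,S_3(\rho_1,\rho_2,\rho_3)\,d\eta\,\rho_2d\rho_2\,\rho_3d\rho_3,$$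 $$S_3(\rho_1,\rho_2,\rho_3)=\frac1{4\pi^3}\int_0^\infty\!\!\int_0^\infty\!\!\int_0^\pi\mathcal T\,\mathcal C(r_1,r_2,r_3)\,d\varphi\,r_2dr_2\,r_3dr_3 .$$ -/

import Mathlib

open MeasureTheory ProbabilityTheory Filter Topology

/-- The Euclidean plane. -/
abbrev Plane : Type := EuclideanSpace ℝ (Fin 2)

noncomputable section

/-- Rotation of the plane by the angle `γ`. -/
def planeRotation (γ : ℝ) (x : Plane) : Plane :=
  !₂[Real.cos γ * x 0 - Real.sin γ * x 1, Real.sin γ * x 0 + Real.cos γ * x 1]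

/-- Reflection of the plane in the first coordinate axis. -/
def planeMirror (x : Plane) : Plane := !₂[x 0, -x 1]

/-- A real random field on the plane that has zero mean and finite third moments, is mean-square
continuous, strictly homogeneous (all finite-dimensional distributions are invariant under
translations) and strictly isotropic (they are invariant under rotations). -/
structure IsHomogeneousIsotropicField {Ω : Type*} [MeasurableSpace Ω] (P : Measure Ω)
    (X : Plane → Ω → ℝ) : Prop where
  memLp_three : ∀ x, MemLp (X x) 3 P
  mean_zero : ∀ x, ∫ ω, X x ω ∂P = 0
  meanSquare_continuous :
    ∀ x, Tendsto (fun y => ∫ ω, (X y ω - X x ω) ^ 2 ∂P) (𝓝 x) (𝓝 0)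
  homogeneous : ∀ (n : ℕ) (x : Fin n → Plane) (h : Plane),
    IdentDistrib (fun ω i => X (x i + h) ω) (fun ω i => X (x i) ω) P P
  isotropic : ∀ (n : ℕ) (x : Fin n → Plane) (γ : ℝ),
    IdentDistrib (fun ω i => X (planeRotation γ (x i)) ω) (fun ω i => X (x i) ω) P P

/-- The joint third-order cumulant (third central moment) of three real random variables. -/
def cum3 {Ω : Type*} [MeasurableSpace Ω] (P : Measure Ω) (U V W : Ω → ℝ) : ℝ :=
  ∫ ω, (U ω - ∫ ω', U ω' ∂P) * (V ω - ∫ ω', V ω' ∂P) * (W ω - ∫ ω', W ω' ∂P) ∂P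

/-- `C r₁ r₂ r₃` is the third-order covariance of the field at the vertices `x₁, x₂, x₃` of a
triangle with side lengths `r₁ = ‖x₃ - x₂‖`, `r₂ = ‖x₂ - x₁‖`, `r₃ = ‖x₃ - x₁‖`. -/
def IsTriangleCovariance {Ω : Type*} [MeasurableSpace Ω] (P : Measure Ω) (X : Plane → Ω → ℝ)
    (C : ℝ → ℝ → ℝ → ℝ) : Prop :=
  ∀ x₁ x₂ x₃ : Plane,
    cum3 P (X x₁) (X x₂) (X x₃) = C ‖x₃ - x₂‖ ‖x₂ - x₁‖ ‖x₃ - x₁‖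

/-- `S` is a bispectral density of the field: the third-order cumulants are
`∫∫∫ exp (i (x₁·ω₁ + x₂·ω₂ + x₃·ω₃)) S(ω₁, ω₂, ω₃) δ(ω₁ + ω₂ + ω₃) dω₁ dω₂ dω₃`,
where the delta function puts `ω₁ = -ω₂ - ω₃`. Here `p = (ω₂, ω₃)`. -/
def IsBispectralDensity {Ω : Type*} [MeasurableSpace Ω] (P : Measure Ω) (X : Plane → Ω → ℝ)
    (S : Plane → Plane → Plane → ℂ) : Prop :=
  Integrable (fun p : Plane × Plane => S (-p.1 - p.2) p.1 p.2) ∧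
  ∀ x₁ x₂ x₃ : Plane,
    (cum3 P (X x₁) (X x₂) (X x₃) : ℂ) =
      ∫ p : Plane × Plane,
        Complex.exp (Complex.I *
          ((inner ℝ x₁ (-p.1 - p.2) + inner ℝ x₂ p.1 + inner ℝ x₃ p.2 : ℝ) : ℂ)) *
        S (-p.1 - p.2) p.1 p.2

/-- The Bessel function of the first kind of order `l`. -/
def besselJ (l : ℕ) (x : ℝ) : ℝ :=
  ∑' m : ℕ, (-1 : ℝ) ^ m / ((m.factorial : ℝ) * ((m + l).factorial : ℝ)) * (x / 2) ^ (2 * m + l)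

/-- The third side of a triangle with sides `a`, `b` enclosing the angle `θ`. -/
def thirdSide (a b θ : ℝ) : ℝ := √(a ^ 2 + b ^ 2 - 2 * a * b * Real.cos θ)

/-- The kernel `J₀(w₊) + J₀(w₋)`, for `q = (ρ₂, ρ₃, η)` and `t = (r₂, r₃, φ)`. -/
def besselKernel (q t : ℝ × ℝ × ℝ) : ℝ :=
  besselJ 0 (thirdSide (q.1 * t.1) (q.2.1 * t.2.1) (q.2.2 + t.2.2)) +
  besselJ 0 (thirdSide (q.1 * t.1) (q.2.1 * t.2.1) (q.2.2 - t.2.2))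

/-- The term of order `l` in the series of `seriesKernel`. -/
def seriesTerm (q t : ℝ × ℝ × ℝ) (l : ℕ) : ℝ :=
  Real.cos (l * t.2.2) * besselJ l (q.1 * t.1) * besselJ l (q.2.1 * t.2.1) * Real.cos (l * q.2.2)

/-- The kernel `T = J₀(ρ₂r₂) J₀(ρ₃r₃) + 2 ∑_{l ≥ 1} cos(lφ) J_l(ρ₂r₂) J_l(ρ₃r₃) cos(lη)`,
for `q = (ρ₂, ρ₃, η)` and `t = (r₂, r₃, φ)`. -/
def seriesKernel (q t : ℝ × ℝ × ℝ) : ℝ :=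
  besselJ 0 (q.1 * t.1) * besselJ 0 (q.2.1 * t.2.1) + 2 * ∑' l : ℕ, seriesTerm q t (l + 1)

/-- The domain of integration: two sides of a triangle and the angle between them. -/
def sidesAngle : Set (ℝ × ℝ × ℝ) := Set.Ioi 0 ×ˢ Set.Ioi 0 ×ˢ Set.Ioo 0 Real.pi

/-- The domain `sidesAngle` with its boundary: degenerate triangles are allowed. -/
def closedSidesAngle : Set (ℝ × ℝ × ℝ) := Set.Ici 0 ×ˢ Set.Ici 0 ×ˢ Set.Icc 0 Real.pi

/-- A function of the three sides of a triangle, in terms of two sides and their angle. -/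
def onTriangles (f : ℝ → ℝ → ℝ → ℝ) (q : ℝ × ℝ × ℝ) : ℝ :=
  f (thirdSide q.1 q.2.1 q.2.2) q.1 q.2.1

/-- `C` and `S` are related by the pair of transforms
`C(r₁, r₂, r₃) = a ∫∫∫ K S(ρ₁, ρ₂, ρ₃) dη ρ₂dρ₂ ρ₃dρ₃` and
`S(ρ₁, ρ₂, ρ₃) = b ∫∫∫ K C(r₁, r₂, r₃) dφ r₂dr₂ r₃dr₃`, where the angle runs over `(0, π)`.
The first integral exists and the formula holds at all triangles. The second formula holds at
almost all triangles at which its integral exists, and at all triangles at which its integral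
exists if `S` is continuous on the set of triangles. -/
def AreTransformPair (K : ℝ × ℝ × ℝ → ℝ × ℝ × ℝ → ℝ) (a b : ℝ)
    (C S : ℝ → ℝ → ℝ → ℝ) : Prop :=
  (∀ r₂ r₃ φ : ℝ, 0 ≤ r₂ → 0 ≤ r₃ →
    IntegrableOn (fun q => K q (r₂, r₃, φ) * onTriangles S q * (q.1 * q.2.1)) sidesAngle ∧
    C (thirdSide r₂ r₃ φ) r₂ r₃ =
      a * ∫ q in sidesAngle, K q (r₂, r₃, φ) * onTriangles S q * (q.1 * q.2.1)) ∧
  (∀ᵐ q ∂(volume.restrict sidesAngle),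
    IntegrableOn (fun t => K q t * onTriangles C t * (t.1 * t.2.1)) sidesAngle →
    onTriangles S q =
      b * ∫ t in sidesAngle, K q t * onTriangles C t * (t.1 * t.2.1)) ∧
  (ContinuousOn (onTriangles S) closedSidesAngle →
    ∀ q ∈ closedSidesAngle,
      IntegrableOn (fun t => K q t * onTriangles C t * (t.1 * t.2.1)) sidesAngle →
      onTriangles S q =
        b * ∫ t in sidesAngle, K q t * onTriangles C t * (t.1 * t.2.1))

end

/-! By homogeneity the cumulant is a function `c(x₂ - x₁, x₃ - x₁)` of a pair of plane vectors,
invariant under simultaneous rotation and reflection of the pair. Two pairs that span with the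
origin triangles of equal sides differ by such a motion (`exists_planeRotation_of_norm_eq`), so `c`
depends on the sides only.

Replacing `ω₃` by `-ω₃` turns the spectral representation into a Fourier transform with phase `⟨z₁,
p₁⟩ - ⟨z₂, p₂⟩`, and `|ω₁|` becomes `|p₁ - p₂|`: the wave numbers are also the sides of a triangle
with a vertex at the origin. Uniqueness of the Fourier transform (`ae_eq_of_pairFourier_eq`) passes
the symmetries of `c` to the density almost everywhere. Rotation by `π` makes `c` even, so the
density is real. Averaging over the motions turns almost everywhere invariance into exact
invariance.

For the transform pair, a pair of vectors is written as a triangle `(ρ₂, ρ₃, η)` rotated by an angle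
`β`. Integrating the plane wave over `β` gives `2π J₀(w₋)`, and folding `-η` onto `η` adds `J₀(w₊)`
(`integral_exp_pairInner_onPairs`). For the inverse, `C` is damped by a Gaussian. The damped inverse
Fourier integral is a Gaussian mean of `S` (`gaussInverse_pairFourier`), which tends to `S` at
points of continuity and, along a sequence, almost everywhere. By the forward formula for the damped
`C` it is also the claimed integral with a Gaussian factor, and dominated convergence removes that
factor whenever the integral exists. The constant is `2π / (2π)⁴`.

The series form is Graf's addition theorem: Parseval's identity for the functions `circleExp`, whose
Fourier coefficients are Bessel functions up to phases. -/

/-! ### Fourier series on the circle and the addition theorem for `J₀` -/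

instance fact_two_pi_pos : Fact (0 < 2 * Real.pi) := ⟨Real.two_pi_pos⟩

/-- The continuous function `exp ((z t - conj (z t)) / 2)` of a point `t` of the unit circle. -/
noncomputable def circleExp (z : ℂ) : C(AddCircle (2 * Real.pi), ℂ) where
  toFun x := Complex.exp (z / 2 * fourier 1 x + -(starRingEnd ℂ z) / 2 * fourier (-1) x)
  continuous_toFun := by
    have h1 := (fourier (T := 2 * Real.pi) 1).continuous
    have h2 := (fourier (T := 2 * Real.pi) (-1)).continuous
    fun_prop

lemma circleExp_apply (z : ℂ) (x : AddCircle (2 * Real.pi)) :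
    circleExp z x =
      Complex.exp (z / 2 * fourier 1 x + -(starRingEnd ℂ z) / 2 * fourier (-1) x) := rfl

lemma fourier_natCast_eq_pow (n : ℕ) (x : AddCircle (2 * Real.pi)) :
    fourier (n : ℤ) x = fourier 1 x ^ n := by
  induction n with
  | zero => simp
  | succ k ih => rw [pow_succ, ← ih, Nat.cast_succ, fourier_add]

lemma fourier_neg_natCast_eq_pow (n : ℕ) (x : AddCircle (2 * Real.pi)) :
    fourier (-(n : ℤ)) x = fourier (-1) x ^ n := by
  rw [fourier_neg, fourier_neg, fourier_natCast_eq_pow, map_pow]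

lemma summable_norm_exp_mul_exp (u v : ℂ) :
    Summable (fun k : ℕ × ℕ => ‖u ^ k.1 / (k.1.factorial : ℂ) * (v ^ k.2 / (k.2.factorial : ℂ))‖) := by
  have h (w : ℂ) : Summable (fun k : ℕ => ‖w ^ k / (k.factorial : ℂ)‖) :=
    NormedSpace.norm_expSeries_div_summable (𝔸 := ℂ) w
  have := (h u).mul_of_nonneg (h v) (fun _ => norm_nonneg _) (fun _ => norm_nonneg _)
  simpa only [norm_mul] using this

lemma hasSum_exp_mul_exp (u v : ℂ) :
    HasSum (fun k : ℕ × ℕ => u ^ k.1 / (k.1.factorial : ℂ) * (v ^ k.2 / (k.2.factorial : ℂ)))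
      (Complex.exp (u + v)) := by
  have h (w : ℂ) : HasSum (fun k : ℕ => w ^ k / (k.factorial : ℂ)) (Complex.exp w) := by
    rw [Complex.exp_eq_exp_ℂ]
    exact NormedSpace.expSeries_div_hasSum_exp (𝔸 := ℂ) w
  have hs : Summable (fun k : ℕ × ℕ =>
      u ^ k.1 / (k.1.factorial : ℂ) * (v ^ k.2 / (k.2.factorial : ℂ))) :=
    (summable_norm_exp_mul_exp u v).of_norm
  have hp := HasSum.mul (h u) (h v) hs
  rwa [← Complex.exp_add] at hp

/-- The Fourier coefficients of `circleExp z` as double power series. -/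
lemma hasSum_fourierCoeff_circleExp (z : ℂ) (n : ℤ) :
    HasSum (fun k : ℕ × ℕ => if (k.1 : ℤ) - k.2 = n then
      (z / 2) ^ k.1 / (k.1.factorial : ℂ) * ((-(starRingEnd ℂ z) / 2) ^ k.2 / (k.2.factorial : ℂ))
      else 0) (fourierCoeff (circleExp z) n) := by
  set u := z / 2
  set v := -(starRingEnd ℂ z) / 2
  set F : ℕ × ℕ → AddCircle (2 * Real.pi) → ℂ := fun k x =>
    (u ^ k.1 / (k.1.factorial : ℂ) * (v ^ k.2 / (k.2.factorial : ℂ))) *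
      fourier ((k.1 : ℤ) - k.2 - n) x with hF
  have hcont (k : ℕ × ℕ) : Continuous (F k) := by
    have := (fourier (T := 2 * Real.pi) ((k.1 : ℤ) - k.2 - n)).continuous
    fun_prop
  have hint (k : ℕ × ℕ) : Integrable (F k) AddCircle.haarAddCircle :=
    (hcont k).integrable_of_hasCompactSupport (HasCompactSupport.of_compactSpace _)
  have hnorm (k : ℕ × ℕ) (x) : ‖F k x‖ =
      ‖u ^ k.1 / (k.1.factorial : ℂ) * (v ^ k.2 / (k.2.factorial : ℂ))‖ := by
    simp only [hF]
    rw [norm_mul _ (fourier _ x), fourier_apply, Circle.norm_coe, mul_one]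
  -- Characters have modulus one, so the double exponential series is dominated by a convergent
  -- series of constants and may be integrated termwise. Orthogonality keeps the terms with `k.1 -
  -- k.2 = n`.
  have key := hasSum_integral_of_summable_integral_norm (μ := AddCircle.haarAddCircle) hint (by
    simp only [hnorm, integral_const, probReal_univ, one_smul]
    exact summable_norm_exp_mul_exp u v)
  convert! key using 1
  · funext k
    have : ∫ x, fourier ((k.1 : ℤ) - k.2 - n) x ∂(AddCircle.haarAddCircle (T := 2 * Real.pi)) =
        if (k.1 : ℤ) - k.2 = n then 1 else 0 := by
      have h := congrFun (fourierCoeff_fourier (T := 2 * Real.pi) ((k.1 : ℤ) - k.2)) n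
      rw [fourierCoeff] at h
      simp only [smul_eq_mul, ← fourier_add] at h
      rw [show (k.1 : ℤ) - k.2 - n = -n + (k.1 - k.2) by ring, h, Pi.single_apply]
      simp [eq_comm]
    simp only [hF]
    rw [integral_const_mul, this]
    split_ifs <;> simp
  · rw [fourierCoeff]
    congr 1
    funext x
    have hs := (hasSum_exp_mul_exp (u * fourier 1 x) (v * fourier (-1) x)).mul_left
      (fourier (-n) x)
    rw [smul_eq_mul, circleExp_apply, ← hs.tsum_eq]
    congr 1
    funext k
    simp only [hF]
    rw [show (k.1 : ℤ) - k.2 - n = -n + ((k.1 : ℤ) + -(k.2 : ℤ)) by ring, fourier_add,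
      fourier_add, fourier_natCast_eq_pow, fourier_neg_natCast_eq_pow]
    ring

/-- The surviving terms of the double series lie on the diagonal `(m + l, m)`. There all but `l` of
the phases cancel, and the sum over `m` is the Bessel series. -/
lemma fourierCoeff_circleExp_natCast (r δ : ℝ) (l : ℕ) :
    fourierCoeff (circleExp (r * Complex.exp (δ * Complex.I))) l =
      Complex.exp (l * δ * Complex.I) * besselJ l r := by
  have h := hasSum_fourierCoeff_circleExp (r * Complex.exp (δ * Complex.I)) l
  have hi : Function.Injective (fun m : ℕ => (m + l, m)) := fun a b hab => (Prod.ext_iff.1 hab).2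
  rw [← hi.hasSum_iff] at h
  · rw [← h.tsum_eq, besselJ, Complex.ofReal_tsum, ← tsum_mul_left]
    congr 1
    funext m
    have hc : (starRingEnd ℂ) (r * Complex.exp (δ * Complex.I)) =
        r * Complex.exp (-(δ * Complex.I)) := by
      rw [map_mul, Complex.conj_ofReal, ← Complex.exp_conj]
      simp
    simp only [Function.comp_apply, hc]
    have he : Complex.exp (l * δ * Complex.I) = Complex.exp (δ * Complex.I) ^ l := by
      rw [← Complex.exp_nat_mul]; ring_nf
    rw [he, Complex.exp_neg]
    have hne := Complex.exp_ne_zero (δ * Complex.I)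
    have h1 : ((m + l).factorial : ℂ) ≠ 0 := by exact_mod_cast (m + l).factorial_ne_zero
    have h2 : (m.factorial : ℂ) ≠ 0 := by exact_mod_cast m.factorial_ne_zero
    rw [if_pos (by push_cast; ring)]
    push_cast
    have h3 : (r * Complex.exp (δ * Complex.I) / 2) ^ (m + l) *
        (-(r * (Complex.exp (δ * Complex.I))⁻¹) / 2) ^ m =
        Complex.exp (δ * Complex.I) ^ l * ((-1) ^ m * (r / 2 : ℂ) ^ (2 * m + l)) := by
      have : (-(r * (Complex.exp (δ * Complex.I))⁻¹) / 2 : ℂ) =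
          (-1) * (r / 2) * (Complex.exp (δ * Complex.I))⁻¹ := by ring
      rw [this, mul_pow, mul_pow,
        show (r * Complex.exp (δ * Complex.I) / 2 : ℂ) = r / 2 * Complex.exp (δ * Complex.I) by ring,
        mul_pow, pow_add (Complex.exp _), inv_pow]
      have := pow_ne_zero m hne
      field_simp
      ring
    rw [div_mul_div_comm, h3]
    field_simp
  · intro k hk
    rw [if_neg]
    intro hk'
    exact hk ⟨k.2, Prod.ext (by simp; omega) rfl⟩

/-- Replacing `z` by `-conj z` exchanges the two exponential factors, hence the two summation
indices. -/
lemma circleExp_neg_index (z : ℂ) (n : ℤ) :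
    fourierCoeff (circleExp z) (-n) = fourierCoeff (circleExp (-(starRingEnd ℂ z))) n := by
  have h := hasSum_fourierCoeff_circleExp z (-n)
  have h' := hasSum_fourierCoeff_circleExp (-(starRingEnd ℂ z)) n
  rw [← (Equiv.prodComm ℕ ℕ).hasSum_iff] at h
  refine h.unique ?_
  convert! h' using 1
  funext k
  simp only [Function.comp_apply, Equiv.prodComm_apply, Prod.fst_swap, Prod.snd_swap, map_neg,
    Complex.conj_conj, neg_neg]
  refine if_congr ⟨fun h => by omega, fun h => by omega⟩ (mul_comm _ _) rfl

lemma fourierCoeff_circleExp_neg_natCast (r δ : ℝ) (l : ℕ) :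
    fourierCoeff (circleExp (r * Complex.exp (δ * Complex.I))) (-(l : ℤ)) =
      (-1) ^ l * Complex.exp (-(l * δ * Complex.I)) * besselJ l r := by
  have : -(starRingEnd ℂ) (r * Complex.exp (δ * Complex.I)) =
      r * Complex.exp ((Real.pi - δ : ℝ) * Complex.I) := by
    rw [map_mul, Complex.conj_ofReal, ← Complex.exp_conj]
    push_cast
    rw [sub_mul, Complex.exp_sub, Complex.exp_pi_mul_I]
    simp only [map_mul, Complex.conj_ofReal, Complex.conj_I, mul_neg, Complex.exp_neg]
    ring
  rw [circleExp_neg_index, this, fourierCoeff_circleExp_natCast]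
  congr 1
  push_cast
  rw [show (l * (Real.pi - δ) * Complex.I : ℂ) = l * (Real.pi * Complex.I) + -(l * δ * Complex.I) by
    ring, Complex.exp_add, Complex.exp_nat_mul, Complex.exp_pi_mul_I]

lemma fourierCoeff_circleExp_zero (z : ℂ) :
    fourierCoeff (circleExp z) 0 = besselJ 0 ‖z‖ := by
  have h := fourierCoeff_circleExp_natCast ‖z‖ z.arg 0
  rw [Complex.norm_mul_exp_arg_mul_I] at h
  simpa using h

lemma norm_sub_mul_exp_eq_thirdSide (a b θ : ℝ) :
    ‖(a - b * Complex.exp (-θ * Complex.I) : ℂ)‖ = thirdSide a b θ := by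
  rw [Complex.norm_def, thirdSide]
  congr 1
  have : (a - b * Complex.exp (-θ * Complex.I) : ℂ) =
      ⟨a - b * Real.cos θ, b * Real.sin θ⟩ := by
    rw [Complex.exp_mul_I]
    apply Complex.ext <;> simp [← Complex.ofReal_cos, ← Complex.ofReal_sin]
  rw [this, Complex.normSq_mk]
  have := Real.sin_sq_add_cos_sq θ
  linear_combination b ^ 2 * this

/-- Graf's addition theorem for `J₀`. -/
theorem hasSum_besselJ_mul_besselJ (a b θ : ℝ) :
    HasSum (fun l : ℕ => 2 * (Real.cos ((l + 1 : ℕ) * θ) * besselJ (l + 1) a * besselJ (l + 1) b))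
      (besselJ 0 (thirdSide a b θ) - besselJ 0 a * besselJ 0 b) := by
  set f := circleExp (a * Complex.exp ((0 : ℝ) * Complex.I))
  set g := circleExp (b * Complex.exp ((-θ : ℝ) * Complex.I))
  set L := fun h : C(AddCircle (2 * Real.pi), ℂ) =>
    ContinuousMap.toLp (E := ℂ) 2 AddCircle.haarAddCircle ℂ h
  -- Parseval for `g` and `f`. The exponent of `circleExp` is purely imaginary and additive in `z`,
  -- so `conj g * f` is again a `circleExp`, with parameter `a - b exp (-iθ)`; its zeroth
  -- coefficient is `J₀` of the modulus.
  have key := (fourierBasis (T := 2 * Real.pi)).hasSum_inner_mul_inner (L g) (L f)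
  have hin : inner ℂ (L g) (L f) = besselJ 0 (thirdSide a b θ) := by
    rw [ContinuousMap.inner_toLp, ← norm_sub_mul_exp_eq_thirdSide, ← fourierCoeff_circleExp_zero,
      fourierCoeff]
    congr 1
    funext x
    simp only [f, g, circleExp_apply]
    rw [← Complex.exp_conj, neg_zero, fourier_zero, one_smul, ← Complex.exp_add]
    congr 1
    have hf : fourier (-1) x = starRingEnd ℂ (fourier 1 x) := fourier_neg
    rw [hf]
    simp only [map_add, map_mul, map_div₀, map_neg, Complex.conj_conj, map_sub, map_ofNat]
    push_cast
    simp only [zero_mul, Complex.exp_zero, map_one, mul_one, neg_mul]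
    ring
  have hcoef (n : ℤ) : inner ℂ (L g) (fourierBasis n) * inner ℂ (fourierBasis n) (L f) =
      starRingEnd ℂ (fourierCoeff g n) * fourierCoeff f n := by
    rw [← inner_conj_symm, ← HilbertBasis.repr_apply_apply, ← HilbertBasis.repr_apply_apply,
      fourierBasis_repr, fourierBasis_repr, fourierCoeff_toLp, fourierCoeff_toLp]
  simp only [hin, hcoef] at key
  have hpos (l : ℕ) : starRingEnd ℂ (fourierCoeff g l) * fourierCoeff f l =
      Complex.exp (l * θ * Complex.I) * (besselJ l a * besselJ l b : ℝ) := by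
    rw [fourierCoeff_circleExp_natCast, fourierCoeff_circleExp_natCast, map_mul,
      ← Complex.exp_conj]
    simp
    ring
  have hneg (l : ℕ) : starRingEnd ℂ (fourierCoeff g (-(l : ℤ))) * fourierCoeff f (-(l : ℤ)) =
      Complex.exp (-(l * θ * Complex.I)) * (besselJ l a * besselJ l b : ℝ) := by
    rw [fourierCoeff_circleExp_neg_natCast, fourierCoeff_circleExp_neg_natCast, map_mul, map_mul,
      ← Complex.exp_conj]
    have : ((-1 : ℂ) ^ l) * (-1) ^ l = 1 := by rw [← mul_pow]; simp
    simp
    linear_combination Complex.exp (-(l * θ * Complex.I)) * (besselJ l a * besselJ l b) * this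
  -- Pairing `n` with `-n` counts `n = 0` twice; splitting off the first term leaves the total minus
  -- one copy of it.
  have h2 := key.nat_add_neg
  rw [hasSum_nat_add_iff' 1 |>.symm] at h2
  rw [← Complex.hasSum_ofReal]
  convert! h2 using 1
  · funext l
    rw [hpos, hneg, ← add_mul]
    push_cast
    rw [Complex.cos]
    ring_nf
  · have h0 := hpos 0
    simp only [Finset.range_one, Finset.sum_singleton, Nat.cast_zero, neg_zero] at h0 ⊢
    rw [h0]
    simp

/-- The product `cos (lφ) cos (lη)` is half the sum of `cos (l(η + φ))` and `cos (l(η - φ))`, so the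
addition theorem is used at both angles. -/
theorem hasSum_seriesTerm (q t : ℝ × ℝ × ℝ) :
    HasSum (fun l => seriesTerm q t (l + 1))
      (1 / 4 * besselKernel q t - 1 / 2 * (besselJ 0 (q.1 * t.1) * besselJ 0 (q.2.1 * t.2.1))) := by
  have h1 := hasSum_besselJ_mul_besselJ (q.1 * t.1) (q.2.1 * t.2.1) (q.2.2 + t.2.2)
  have h2 := hasSum_besselJ_mul_besselJ (q.1 * t.1) (q.2.1 * t.2.1) (q.2.2 - t.2.2)
  convert! (h1.add h2).mul_left (1 / 4) using 1
  · funext l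
    rw [seriesTerm, mul_add ((l + 1 : ℕ) : ℝ), mul_sub ((l + 1 : ℕ) : ℝ), Real.cos_add,
      Real.cos_sub]
    ring
  · rw [besselKernel]
    ring

theorem summable_seriesTerm (q t : ℝ × ℝ × ℝ) : Summable (seriesTerm q t) :=
  (summable_nat_add_iff 1).1 (hasSum_seriesTerm q t).summable

theorem seriesKernel_eq (q t : ℝ × ℝ × ℝ) : seriesKernel q t = 1 / 2 * besselKernel q t := by
  rw [seriesKernel, (hasSum_seriesTerm q t).tsum_eq]
  ring

/-- Bessel's integral for `J₀`, with the phase of a plane wave. -/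
theorem integral_exp_cos_add_sin (A B : ℝ) :
    ∫ β in Set.Ioo (-Real.pi) Real.pi,
      Complex.exp (Complex.I * ((A * Real.cos β + B * Real.sin β : ℝ) : ℂ)) =
      2 * Real.pi * besselJ 0 √(A ^ 2 + B ^ 2) := by
  have hz : ‖(⟨B, A⟩ : ℂ)‖ = √(A ^ 2 + B ^ 2) := by
    rw [Complex.norm_def, Complex.normSq_mk]; ring_nf
  -- With `z = B + iA` and `t = exp (iβ)` the exponent `i Im (z t)` is the phase `i (A cos β + B sin
  -- β)`.
  have h := fourierCoeff_eq_intervalIntegral (circleExp ⟨B, A⟩) 0 (-Real.pi)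
  rw [fourierCoeff_circleExp_zero, hz, show -Real.pi + 2 * Real.pi = Real.pi by ring,
    intervalIntegral.integral_of_le (by linarith [Real.pi_pos]), integral_Ioc_eq_integral_Ioo] at h
  rw [h]
  have hp : (Real.pi : ℂ) ≠ 0 := by exact_mod_cast Real.pi_ne_zero
  rw [Complex.real_smul]
  push_cast
  field_simp
  congr 1
  funext β
  rw [neg_zero, fourier_zero, one_smul, circleExp_apply, fourier_coe_apply, fourier_coe_apply]
  congr 1
  push_cast
  have e1 : (2 * Real.pi * Complex.I * 1 * β / (2 * Real.pi) : ℂ) = β * Complex.I := by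
    field_simp
  have e2 : (2 * Real.pi * Complex.I * (-1) * β / (2 * Real.pi) : ℂ) = (-β) * Complex.I := by
    field_simp
  rw [e1, e2, Complex.exp_mul_I, Complex.exp_mul_I, Complex.cos_neg, Complex.sin_neg]
  have e3 : (⟨B, A⟩ : ℂ) = B + A * Complex.I := Complex.mk_eq_add_mul_I _ _
  rw [e3]
  simp only [map_add, map_mul, Complex.conj_ofReal, Complex.conj_I]
  ring_nf

/-! ### Plane isometries, polar coordinates and congruence of triangles -/

/-- The point of the plane with polar coordinates `p`. -/
noncomputable def planePolar (p : ℝ × ℝ) : Plane := !₂[p.1 * Real.cos p.2, p.1 * Real.sin p.2]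

@[simp] lemma planePolar_apply_zero (p : ℝ × ℝ) : planePolar p 0 = p.1 * Real.cos p.2 := rfl
@[simp] lemma planePolar_apply_one (p : ℝ × ℝ) : planePolar p 1 = p.1 * Real.sin p.2 := rfl
@[simp] lemma planeRotation_apply_zero (γ : ℝ) (x : Plane) :
    planeRotation γ x 0 = Real.cos γ * x 0 - Real.sin γ * x 1 := rfl
@[simp] lemma planeRotation_apply_one (γ : ℝ) (x : Plane) :
    planeRotation γ x 1 = Real.sin γ * x 0 + Real.cos γ * x 1 := rfl
@[simp] lemma planeMirror_apply_zero (x : Plane) : planeMirror x 0 = x 0 := rfl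
@[simp] lemma planeMirror_apply_one (x : Plane) : planeMirror x 1 = -x 1 := rfl

lemma plane_ext {x y : Plane} (h0 : x 0 = y 0) (h1 : x 1 = y 1) : x = y := by
  ext i; fin_cases i <;> assumption

lemma plane_norm_sq (x : Plane) : ‖x‖ ^ 2 = x 0 ^ 2 + x 1 ^ 2 := by
  rw [EuclideanSpace.norm_sq_eq]; simp

lemma plane_inner (x y : Plane) : inner ℝ x y = x 0 * y 0 + x 1 * y 1 := by
  simp [PiLp.inner_apply, mul_comm]

lemma planeRotation_norm (γ : ℝ) (x : Plane) : ‖planeRotation γ x‖ = ‖x‖ := by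
  rw [← sq_eq_sq₀ (norm_nonneg _) (norm_nonneg _), plane_norm_sq, plane_norm_sq]
  simp only [planeRotation_apply_zero, planeRotation_apply_one]
  linear_combination (x 0 ^ 2 + x 1 ^ 2) * Real.sin_sq_add_cos_sq γ

/-- Rotation of the plane as a linear isometry. -/
noncomputable def planeRotationEquiv (γ : ℝ) : Plane ≃ₗᵢ[ℝ] Plane where
  toFun := planeRotation γ
  invFun := planeRotation (-γ)
  map_add' x y := plane_ext (by simp; ring) (by simp; ring)
  map_smul' c x := plane_ext (by simp; ring) (by simp; ring)
  left_inv x := plane_ext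
    (by simp; linear_combination x 0 * Real.sin_sq_add_cos_sq γ)
    (by simp; linear_combination x 1 * Real.sin_sq_add_cos_sq γ)
  right_inv x := plane_ext
    (by simp; linear_combination x 0 * Real.sin_sq_add_cos_sq γ)
    (by simp; linear_combination x 1 * Real.sin_sq_add_cos_sq γ)
  norm_map' := planeRotation_norm γ

lemma planeRotationEquiv_apply (γ : ℝ) (x : Plane) :
    planeRotationEquiv γ x = planeRotation γ x := rfl

/-- Reflection in the first coordinate axis as a linear isometry. -/
noncomputable def planeMirrorEquiv : Plane ≃ₗᵢ[ℝ] Plane where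
  toFun := planeMirror
  invFun := planeMirror
  map_add' x y := plane_ext (by simp) (by simp; ring)
  map_smul' c x := plane_ext (by simp) (by simp)
  left_inv x := plane_ext (by simp) (by simp)
  right_inv x := plane_ext (by simp) (by simp)
  norm_map' x := by
    rw [← sq_eq_sq₀ (norm_nonneg _) (norm_nonneg _), plane_norm_sq, plane_norm_sq]
    simp [planeMirror]

lemma planeMirrorEquiv_apply (x : Plane) : planeMirrorEquiv x = planeMirror x := rfl

lemma planeRotation_planePolar (γ : ℝ) (p : ℝ × ℝ) :
    planeRotation γ (planePolar p) = planePolar (p.1, p.2 + γ) :=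
  plane_ext (by simp [Real.cos_add]; ring) (by simp [Real.sin_add]; ring)

lemma planeMirror_planePolar (p : ℝ × ℝ) :
    planeMirror (planePolar p) = planePolar (p.1, -p.2) :=
  plane_ext (by simp) (by simp)

lemma exists_planePolar (x : Plane) : ∃ θ, x = planePolar (‖x‖, θ) := by
  refine ⟨Complex.arg ⟨x 0, x 1⟩, ?_⟩
  have h : ‖(⟨x 0, x 1⟩ : ℂ)‖ = ‖x‖ := by
    rw [← sq_eq_sq₀ (norm_nonneg _) (norm_nonneg _), plane_norm_sq, Complex.sq_norm,
      Complex.normSq_mk]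
    ring
  refine plane_ext ?_ ?_
  · rw [planePolar_apply_zero, ← h, Complex.norm_mul_cos_arg]
  · rw [planePolar_apply_one, ← h, Complex.norm_mul_sin_arg]

lemma norm_planePolar (p : ℝ × ℝ) : ‖planePolar p‖ = |p.1| := by
  rw [← sq_eq_sq₀ (norm_nonneg _) (abs_nonneg _), plane_norm_sq, sq_abs]
  simp only [planePolar_apply_zero, planePolar_apply_one]
  linear_combination p.1 ^ 2 * Real.sin_sq_add_cos_sq p.2

lemma inner_planePolar (p q : ℝ × ℝ) :
    inner ℝ (planePolar p) (planePolar q) = p.1 * q.1 * Real.cos (p.2 - q.2) := by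
  rw [plane_inner, Real.cos_sub]
  simp only [planePolar_apply_zero, planePolar_apply_one]
  ring

lemma norm_planePolar_sub (p q : ℝ × ℝ) :
    ‖planePolar p - planePolar q‖ = thirdSide p.1 q.1 (p.2 - q.2) := by
  rw [thirdSide, ← Real.sqrt_sq (norm_nonneg _), norm_sub_sq_real, norm_planePolar, norm_planePolar,
    inner_planePolar, sq_abs, sq_abs]
  ring_nf

lemma thirdSide_neg_angle (a b θ : ℝ) : thirdSide a b (-θ) = thirdSide a b θ := by
  simp [thirdSide]

lemma planePolar_add_int_mul_two_pi (r θ : ℝ) (k : ℤ) :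
    planePolar (r, θ + k * (2 * Real.pi)) = planePolar (r, θ) :=
  plane_ext (by simp) (by simp)

/-- Congruent triangles with a vertex at the origin are related by a rotation, possibly preceded
by a reflection. -/
theorem exists_planeRotation_of_norm_eq {a b a' b' : Plane} (ha : ‖a‖ = ‖a'‖) (hb : ‖b‖ = ‖b'‖)
    (hab : ‖a - b‖ = ‖a' - b'‖) :
    ∃ γ, (planeRotation γ a = a' ∧ planeRotation γ b = b') ∨
      (planeRotation γ (planeMirror a) = a' ∧ planeRotation γ (planeMirror b) = b') := by
  obtain ⟨α, hα⟩ := exists_planePolar a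
  obtain ⟨β, hβ⟩ := exists_planePolar b
  obtain ⟨α', hα'⟩ := exists_planePolar a'
  obtain ⟨β', hβ'⟩ := exists_planePolar b'
  rw [← ha] at hα'
  rw [← hb] at hβ'
  have hin : inner ℝ a b = inner ℝ a' b' := by
    have h1 := norm_sub_sq_real a b
    have h2 := norm_sub_sq_real a' b'
    rw [hab, ha, hb] at h1
    linarith
  generalize hr : ‖a‖ = r at *
  generalize hs : ‖b‖ = s at *
  subst hα hβ hα' hβ'
  rw [inner_planePolar, inner_planePolar] at hin
  simp only [planeRotation_planePolar, planeMirror_planePolar]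
  simp only at hin
  -- If one of the points is the origin, there is no angle to match and a rotation moves the other
  -- into place.
  rcases eq_or_ne r 0 with rfl | hr0
  · refine ⟨β' - β, Or.inl ⟨plane_ext (by simp) (by simp), ?_⟩⟩
    congr 2; ring
  rcases eq_or_ne s 0 with rfl | hs0
  · refine ⟨α' - α, Or.inl ⟨?_, plane_ext (by simp) (by simp)⟩⟩
    congr 2; ring
  -- The angles between the two vectors have equal cosines, so they agree modulo `2π` up to sign;
  -- the sign decides whether a reflection is needed.
  have hcos := mul_left_cancel₀ (mul_ne_zero hr0 hs0) hin
  obtain ⟨k, hk | hk⟩ := Real.cos_eq_cos_iff.1 hcos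
  · refine ⟨α' - α, Or.inl ⟨by congr 2; ring, ?_⟩⟩
    rw [← planePolar_add_int_mul_two_pi s β' k]
    congr 2; linarith
  · refine ⟨α' + α, Or.inr ⟨by congr 2; ring, ?_⟩⟩
    rw [← planePolar_add_int_mul_two_pi s β' k]
    congr 2; linarith

/-! ### Lebesgue measure on pairs of vectors in triangle coordinates -/

/-- The measure `ρ dρ` on the positive half-line. -/
noncomputable def radialMeasure : Measure ℝ :=
  (volume.restrict (Set.Ioi 0)).withDensity (fun ρ => ENNReal.ofReal ρ)

/-- Lebesgue measure on the angles in `(-π, π)`. -/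
noncomputable def angleMeasure : Measure ℝ := volume.restrict (Set.Ioo (-Real.pi) Real.pi)

instance : SFinite radialMeasure := by unfold radialMeasure; infer_instance
instance : IsFiniteMeasure angleMeasure := by unfold angleMeasure; infer_instance

/-- Lebesgue measure on two sides and the signed angle between them, with its polar density. -/
noncomputable def sidesMeasure : Measure (ℝ × ℝ × ℝ) :=
  radialMeasure.prod (radialMeasure.prod angleMeasure)

instance : SFinite sidesMeasure := by unfold sidesMeasure; infer_instance

lemma continuous_planePolar : Continuous planePolar := by
  unfold planePolar
  refine (PiLp.continuous_toLp 2 _).comp (continuous_pi fun i => ?_)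
  fin_cases i
  · simp; fun_prop
  · simp; fun_prop

theorem measurePreserving_planePolar :
    MeasurePreserving planePolar (radialMeasure.prod angleMeasure) volume := by
  have hmeas : radialMeasure.prod angleMeasure =
      (volume.restrict polarCoord.target).withDensity (fun p => ENNReal.ofReal p.1) := by
    rw [radialMeasure, angleMeasure, prod_withDensity_left (by fun_prop), Measure.prod_restrict]
    rfl
  have h1 : MeasurePreserving (polarCoord.symm : ℝ × ℝ → ℝ × ℝ)
      (radialMeasure.prod angleMeasure) volume := by
    refine ⟨continuous_polarCoord_symm.measurable, ?_⟩
    ext s hs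
    rw [Measure.map_apply continuous_polarCoord_symm.measurable hs, hmeas,
      withDensity_apply _ (continuous_polarCoord_symm.measurable hs)]
    rw [← lintegral_indicator_one hs, ← lintegral_comp_polarCoord_symm,
      ← lintegral_indicator (continuous_polarCoord_symm.measurable hs)]
    refine lintegral_congr fun p => ?_
    by_cases hp : polarCoord.symm p ∈ s
    · rw [Set.indicator_of_mem (show p ∈ polarCoord.symm ⁻¹' s from hp),
        Set.indicator_of_mem hp]; simp
    · rw [Set.indicator_of_notMem (show p ∉ polarCoord.symm ⁻¹' s from hp),
        Set.indicator_of_notMem hp]; simp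
  have h2 := (PiLp.volume_preserving_toLp (Fin 2)).comp
    (((volume_preserving_finTwoArrow ℝ).symm).comp h1)
  convert! h2 using 1

/-- The pair of points that span with the origin a triangle with given sides and angle, rotated
by a further angle. -/
noncomputable def trianglePoint (p : (ℝ × ℝ × ℝ) × ℝ) : Plane × Plane :=
  (planePolar (p.1.1, p.2), planePolar (p.1.2.1, p.1.2.2 + p.2))

/-- The second point is measured from the direction of the first. For a fixed first point this only
rotates the second, which preserves area, so the map is a skew product over polar coordinates. -/
theorem measurePreserving_trianglePoint :
    MeasurePreserving trianglePoint (sidesMeasure.prod angleMeasure) volume := by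
  have h1 : MeasurePreserving (fun p : (ℝ × ℝ) × (ℝ × ℝ) =>
      (planePolar p.1, planePolar (p.2.1, p.2.2 + p.1.2)))
      ((radialMeasure.prod angleMeasure).prod (radialMeasure.prod angleMeasure))
      ((volume : Measure Plane).prod volume) := by
    refine measurePreserving_planePolar.skew_product
      (g := fun (a b : ℝ × ℝ) => planePolar (b.1, b.2 + a.2)) ?_ (ae_of_all _ fun a => ?_)
    · have := continuous_planePolar.measurable
      unfold Function.uncurry
      fun_prop
    · have h := (planeRotationEquiv a.2).measurePreserving.comp measurePreserving_planePolar
      have he : (fun b : ℝ × ℝ => planePolar (b.1, b.2 + a.2)) =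
          (planeRotationEquiv a.2) ∘ planePolar := by
        funext b
        rw [Function.comp_apply, planeRotationEquiv_apply, planeRotation_planePolar]
      rw [he]
      exact h.map_eq
  have h2 : MeasurePreserving (fun p : (ℝ × ℝ × ℝ) × ℝ => ((p.1.1, p.2), p.1.2))
      (sidesMeasure.prod angleMeasure)
      ((radialMeasure.prod angleMeasure).prod (radialMeasure.prod angleMeasure)) := by
    have e1 := measurePreserving_prodAssoc radialMeasure (radialMeasure.prod angleMeasure)
      angleMeasure
    have e2 : MeasurePreserving (Prod.map (id : ℝ → ℝ)
        (Prod.swap : (ℝ × ℝ) × ℝ → ℝ × (ℝ × ℝ)))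
        (radialMeasure.prod ((radialMeasure.prod angleMeasure).prod angleMeasure))
        (radialMeasure.prod (angleMeasure.prod (radialMeasure.prod angleMeasure))) :=
      (MeasurePreserving.id _).prod Measure.measurePreserving_swap
    have e3 := (measurePreserving_prodAssoc radialMeasure angleMeasure
      (radialMeasure.prod angleMeasure)).symm
    exact e3.comp (e2.comp e1)
  exact h1.comp h2

lemma sidesMeasure_eq : sidesMeasure =
    (volume.restrict (Set.Ioi 0 ×ˢ Set.Ioi 0 ×ˢ Set.Ioo (-Real.pi) Real.pi)).withDensity
      (fun q => ENNReal.ofReal (q.1 * q.2.1)) := by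
  have h : radialMeasure.prod angleMeasure =
      (volume.restrict (Set.Ioi 0 ×ˢ Set.Ioo (-Real.pi) Real.pi)).withDensity
        (fun p : ℝ × ℝ => ENNReal.ofReal p.1) := by
    rw [radialMeasure, angleMeasure, prod_withDensity_left (by fun_prop), Measure.prod_restrict]
    rfl
  rw [sidesMeasure, h, radialMeasure, prod_withDensity (by fun_prop) (by fun_prop),
    Measure.prod_restrict]
  refine withDensity_congr_ae ?_
  refine (ae_restrict_iff' (by measurability)).2 (ae_of_all _ fun q hq => ?_)
  exact (ENNReal.ofReal_mul (le_of_lt hq.1)).symm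

lemma measurableSet_sidesAngle : MeasurableSet sidesAngle :=
  measurableSet_Ioi.prod (measurableSet_Ioi.prod measurableSet_Ioo)

lemma ae_restrict_sidesAngle_of_ae_sidesMeasure {p : ℝ × ℝ × ℝ → Prop}
    (h : ∀ᵐ q ∂sidesMeasure, p q) : ∀ᵐ q ∂(volume.restrict sidesAngle), p q := by
  rw [sidesMeasure_eq, ae_withDensity_iff (by fun_prop),
    ae_restrict_iff' (by measurability)] at h
  rw [ae_restrict_iff' measurableSet_sidesAngle]
  filter_upwards [h] with q hq hs
  refine hq ⟨hs.1, hs.2.1, by linarith [hs.2.2.1, Real.pi_pos], hs.2.2.2⟩ ?_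
  have : 0 < q.1 * q.2.1 := mul_pos hs.1 hs.2.1
  simpa using this

lemma ae_sidesMeasure_pos : ∀ᵐ q ∂sidesMeasure, 0 < q.1 ∧ 0 < q.2.1 := by
  rw [sidesMeasure_eq]
  refine (withDensity_absolutelyContinuous _ _).ae_le ?_
  refine (ae_restrict_iff' (by measurability)).2 (ae_of_all _ fun q hq => ⟨hq.1, hq.2.1⟩)

/-- Folding of the signed angle onto `(0, π)`. -/
theorem integral_sidesMeasure {F : ℝ × ℝ × ℝ → ℝ} (hF : Integrable F sidesMeasure) :
    IntegrableOn (fun q => (F q + F (q.1, q.2.1, -q.2.2)) * (q.1 * q.2.1)) sidesAngle ∧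
    ∫ q, F q ∂sidesMeasure =
      ∫ q in sidesAngle, (F q + F (q.1, q.2.1, -q.2.2)) * (q.1 * q.2.1) := by
  set D : Set (ℝ × ℝ × ℝ) := Set.Ioi 0 ×ˢ Set.Ioi 0 ×ˢ Set.Ioo (-Real.pi) Real.pi with hD
  set N : Set (ℝ × ℝ × ℝ) := Set.Ioi 0 ×ˢ Set.Ioi 0 ×ˢ Set.Ioo (-Real.pi) 0 with hN
  have hDm : MeasurableSet D := by measurability
  have hNm : MeasurableSet N := by measurability
  set W : ℝ × ℝ × ℝ → ℝ := fun q => F q * (q.1 * q.2.1) with hW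
  have hpos : ∀ q ∈ D, (ENNReal.ofReal (q.1 * q.2.1)).toReal • F q = W q := fun q hq => by
    rw [ENNReal.toReal_ofReal (mul_nonneg (le_of_lt hq.1) (le_of_lt hq.2.1)), smul_eq_mul, mul_comm]
  have hWD : IntegrableOn W D := by
    rw [sidesMeasure_eq, integrable_withDensity_iff_integrable_smul' (by fun_prop)
      (ae_of_all _ fun _ => ENNReal.ofReal_lt_top)] at hF
    exact IntegrableOn.congr_fun hF hpos hDm
  have hWint : ∫ q, F q ∂sidesMeasure = ∫ q in D, W q := by
    rw [sidesMeasure_eq, integral_withDensity_eq_integral_toReal_smul (by fun_prop)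
      (ae_of_all _ fun _ => ENNReal.ofReal_lt_top)]
    exact setIntegral_congr_fun hDm hpos
  have hdisj : Disjoint N sidesAngle := by
    rw [Set.disjoint_left]
    intro q h1 h2
    exact lt_asymm h1.2.2.2 h2.2.2.1
  have hsubN : N ⊆ D := fun q h => ⟨h.1, h.2.1, h.2.2.1, h.2.2.2.trans Real.pi_pos⟩
  have hsubS : sidesAngle ⊆ D := fun q h =>
    ⟨h.1, h.2.1, by linarith [h.2.2.1, Real.pi_pos], h.2.2.2⟩
  have hae : D =ᵐ[volume] (N ∪ sidesAngle : Set (ℝ × ℝ × ℝ)) := by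
    refine EventuallyLE.antisymm ?_ (Eventually.of_forall (Set.union_subset hsubN hsubS))
    have hnull : ∀ᵐ q : ℝ × ℝ × ℝ, q.2.2 ≠ 0 := by
      have : volume ((Set.univ : Set ℝ) ×ˢ (Set.univ : Set ℝ) ×ˢ ({0} : Set ℝ)) = 0 := by
        rw [Measure.volume_eq_prod, Measure.prod_prod, Measure.volume_eq_prod, Measure.prod_prod]
        simp
      refine measure_mono_null (fun q hq => ?_) this
      simpa using hq
    filter_upwards [hnull] with q hq hqD
    rcases lt_or_gt_of_ne hq with h | h
    · exact Or.inl ⟨hqD.1, hqD.2.1, hqD.2.2.1, h⟩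
    · exact Or.inr ⟨hqD.1, hqD.2.1, h, hqD.2.2.2⟩
  -- Reversing the sign of the angle carries the positive half of the domain onto the negative half.
  let e : ℝ × ℝ × ℝ ≃ᵐ ℝ × ℝ × ℝ := MeasurableEquiv.prodCongr (MeasurableEquiv.refl ℝ)
    (MeasurableEquiv.prodCongr (MeasurableEquiv.refl ℝ) (MeasurableEquiv.neg ℝ))
  have he : MeasurePreserving e volume volume :=
    (MeasurePreserving.id volume).prod
      ((MeasurePreserving.id volume).prod (Measure.measurePreserving_neg volume))
  have hpre : e ⁻¹' N = sidesAngle := by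
    ext q
    have heq : e q = (q.1, q.2.1, -q.2.2) := rfl
    rw [Set.mem_preimage, heq]
    simp [hN, sidesAngle, and_comm]
  have hWe : ∀ q, W (e q) = F (q.1, q.2.1, -q.2.2) * (q.1 * q.2.1) := fun q => rfl
  have i1 : IntegrableOn W sidesAngle := hWD.mono_set hsubS
  have i2 : IntegrableOn (W ∘ e) sidesAngle := by
    rw [← hpre, he.integrableOn_comp_preimage e.measurableEmbedding]
    exact hWD.mono_set hsubN
  have hsum : (fun q => (F q + F (q.1, q.2.1, -q.2.2)) * (q.1 * q.2.1)) =
      fun q => W q + (W ∘ e) q := by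
    funext q
    rw [Function.comp_apply, hWe, add_mul]
  rw [hsum]
  refine ⟨i1.add i2, ?_⟩
  rw [integral_add i1 i2, hWint, setIntegral_congr_set hae,
    setIntegral_union hdisj measurableSet_sidesAngle (hWD.mono_set hsubN) i1, add_comm]
  congr 1
  rw [← hpre]
  exact (he.setIntegral_preimage_emb e.measurableEmbedding W N).symm

/-! ### Fourier transforms of functions of the sides of a triangle -/

lemma besselJ_zero_neg (x : ℝ) : besselJ 0 (-x) = besselJ 0 x := by
  unfold besselJ
  congr 1
  funext m
  rw [neg_div, add_zero, add_zero, (even_two_mul m).neg_pow (x / 2)]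

lemma besselJ_zero_eq (x : ℝ) : (besselJ 0 x : ℂ) = (2 * Real.pi : ℂ)⁻¹ *
    ∫ β in Set.Ioo (-Real.pi) Real.pi, Complex.exp (Complex.I * ((x * Real.cos β : ℝ) : ℂ)) := by
  have h := integral_exp_cos_add_sin x 0
  simp only [zero_mul, add_zero] at h
  have hs : besselJ 0 √(x ^ 2 + 0 ^ 2) = besselJ 0 x := by
    rw [zero_pow two_ne_zero, add_zero, Real.sqrt_sq_eq_abs]
    rcases abs_choice x with h | h <;> rw [h]
    exact besselJ_zero_neg x
  have hp : (Real.pi : ℂ) ≠ 0 := by exact_mod_cast Real.pi_ne_zero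
  rw [h, hs]
  field_simp

lemma norm_exp_I_mul_ofReal (x : ℝ) : ‖Complex.exp (Complex.I * (x : ℂ))‖ = 1 := by
  rw [mul_comm, Complex.norm_exp_ofReal_mul_I]

lemma abs_besselJ_zero_le (x : ℝ) : |besselJ 0 x| ≤ 1 := by
  have h := norm_setIntegral_le_of_norm_le_const
    (f := fun β : ℝ => Complex.exp (Complex.I * ((x * Real.cos β : ℝ) : ℂ)))
    (s := Set.Ioo (-Real.pi) Real.pi) (μ := volume) (C := 1) (by simp)
    (fun β _ => (norm_exp_I_mul_ofReal _).le)
  rw [Real.volume_real_Ioo_of_le (by linarith [Real.pi_pos])] at h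
  rw [← Real.norm_eq_abs, ← Complex.norm_real, besselJ_zero_eq, norm_mul]
  have h2 : ‖(2 * Real.pi : ℂ)⁻¹‖ = (2 * Real.pi)⁻¹ := by
    rw [norm_inv, norm_mul, Complex.norm_real, Real.norm_of_nonneg Real.pi_pos.le]; simp
  rw [h2, inv_mul_le_iff₀ Real.two_pi_pos]
  linarith

lemma continuous_besselJ_zero : Continuous (besselJ 0) := by
  have h : Continuous fun x : ℝ => ∫ β in Set.Ioo (-Real.pi) Real.pi,
      Complex.exp (Complex.I * ((x * Real.cos β : ℝ) : ℂ)) := by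
    refine continuous_of_dominated (bound := fun _ => 1) (fun x => ?_)
      (fun x => ae_of_all _ fun β => (norm_exp_I_mul_ofReal _).le) (integrable_const _)
      (ae_of_all _ fun β => by fun_prop)
    exact Continuous.aestronglyMeasurable (by fun_prop)
  have h2 : besselJ 0 = fun x => ((2 * Real.pi : ℂ)⁻¹ * ∫ β in Set.Ioo (-Real.pi) Real.pi,
      Complex.exp (Complex.I * ((x * Real.cos β : ℝ) : ℂ))).re := by
    funext x
    rw [← besselJ_zero_eq, Complex.ofReal_re]
  rw [h2]
  fun_prop

lemma continuous_thirdSide {α : Type*} [TopologicalSpace α] {a b θ : α → ℝ} (ha : Continuous a)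
    (hb : Continuous b) (hθ : Continuous θ) : Continuous fun x => thirdSide (a x) (b x) (θ x) := by
  unfold thirdSide; fun_prop

lemma besselKernel_comm (q t : ℝ × ℝ × ℝ) : besselKernel q t = besselKernel t q := by
  unfold besselKernel
  rw [mul_comm q.1, mul_comm q.2.1, add_comm q.2.2, ← neg_sub t.2.2, thirdSide_neg_angle]

/-- The sum of the two inner products of the Fourier transform on pairs of points. -/
noncomputable def pairInner (z y : Plane × Plane) : ℝ := inner ℝ z.1 y.1 - inner ℝ z.2 y.2

lemma continuous_pairInner : Continuous fun p : (Plane × Plane) × (Plane × Plane) =>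
    pairInner p.1 p.2 := by
  unfold pairInner; fun_prop

lemma pairInner_trianglePoint (t q : ℝ × ℝ × ℝ) (α β : ℝ) :
    pairInner (trianglePoint (t, α)) (trianglePoint (q, β)) =
      (q.1 * t.1 * Real.cos α - q.2.1 * t.2.1 * Real.cos (q.2.2 - t.2.2 - α)) * Real.cos β +
      (q.1 * t.1 * Real.sin α + q.2.1 * t.2.1 * Real.sin (q.2.2 - t.2.2 - α)) * Real.sin β := by
  simp only [pairInner, trianglePoint, inner_planePolar]
  rw [show t.2.2 + α - (q.2.2 + β) = -((q.2.2 - t.2.2 - α) + β) by ring, Real.cos_neg,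
    Real.cos_sub α, Real.cos_add (q.2.2 - t.2.2 - α)]
  ring

/-- As a function of `β` the phase is `A cos β + B sin β`, and `A² + B²` is the squared third side,
whatever `α` is. -/
lemma integral_exp_pairInner_trianglePoint (t q : ℝ × ℝ × ℝ) (α : ℝ) :
    ∫ β, Complex.exp (Complex.I *
      (pairInner (trianglePoint (t, α)) (trianglePoint (q, β)) : ℂ)) ∂angleMeasure =
      2 * Real.pi * besselJ 0 (thirdSide (q.1 * t.1) (q.2.1 * t.2.1) (q.2.2 - t.2.2)) := by
  simp only [pairInner_trianglePoint, angleMeasure]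
  rw [integral_exp_cos_add_sin, thirdSide]
  congr 4
  have h : Real.cos (q.2.2 - t.2.2) = Real.cos α * Real.cos (q.2.2 - t.2.2 - α) -
      Real.sin α * Real.sin (q.2.2 - t.2.2 - α) := by
    rw [← Real.cos_add]; ring_nf
  rw [h]
  linear_combination (q.2.1 * t.2.1) ^ 2 * Real.sin_sq_add_cos_sq (q.2.2 - t.2.2 - α) +
    (q.1 * t.1) ^ 2 * Real.sin_sq_add_cos_sq α

/-- The function of two points of the plane given by a function of the sides of the triangle they
span with the origin. -/
noncomputable def onPairs (g : ℝ → ℝ → ℝ → ℝ) (p : Plane × Plane) : ℝ := g ‖p.1 - p.2‖ ‖p.1‖ ‖p.2‖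

lemma onPairs_trianglePoint (g : ℝ → ℝ → ℝ → ℝ) {q : ℝ × ℝ × ℝ} (h1 : 0 ≤ q.1) (h2 : 0 ≤ q.2.1)
    (β : ℝ) : onPairs g (trianglePoint (q, β)) = onTriangles g q := by
  rw [onPairs, trianglePoint, norm_planePolar_sub, norm_planePolar, norm_planePolar, onTriangles,
    abs_of_nonneg h1, abs_of_nonneg h2]
  simp only
  rw [show β - (q.2.2 + β) = -q.2.2 by ring, thirdSide_neg_angle]

lemma ae_onPairs_trianglePoint (g : ℝ → ℝ → ℝ → ℝ) :
    ∀ᵐ p ∂(sidesMeasure.prod angleMeasure), onPairs g (trianglePoint p) = onTriangles g p.1 := by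
  filter_upwards [Measure.quasiMeasurePreserving_fst.ae ae_sidesMeasure_pos] with p hp
  exact onPairs_trianglePoint g hp.1.le hp.2.le p.2

lemma angleMeasure_ne_zero : angleMeasure ≠ 0 := by
  rw [angleMeasure, Ne, Measure.restrict_eq_zero, Real.volume_Ioo]
  simp; linarith [Real.pi_pos]

/-- In triangle coordinates the function does not depend on the rotation angle, so one integrable
section from Fubini is enough. -/
lemma integrable_onTriangles {g : ℝ → ℝ → ℝ → ℝ} (hg : Integrable (onPairs g)) :
    Integrable (onTriangles g) sidesMeasure := by
  have h1 := measurePreserving_trianglePoint.integrable_comp_of_integrable hg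
  have h2 : Integrable (fun p : (ℝ × ℝ × ℝ) × ℝ => onTriangles g p.1)
      (sidesMeasure.prod angleMeasure) := h1.congr (ae_onPairs_trianglePoint g)
  have h3 := h2.prod_left_ae
  have : NeZero angleMeasure := ⟨angleMeasure_ne_zero⟩
  exact h3.exists.choose_spec

/-- The Fourier transform of a function of the sides of a triangle. -/
theorem integral_exp_pairInner_onPairs {g : ℝ → ℝ → ℝ → ℝ} (hg : Integrable (onPairs g))
    (t : ℝ × ℝ × ℝ) (α : ℝ) :
    IntegrableOn (fun q => besselKernel q t * onTriangles g q * (q.1 * q.2.1)) sidesAngle ∧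
    ∫ p, Complex.exp (Complex.I * (pairInner (trianglePoint (t, α)) p : ℂ)) * (onPairs g p : ℂ) =
      ((2 * Real.pi * ∫ q in sidesAngle,
        besselKernel q t * onTriangles g q * (q.1 * q.2.1) : ℝ) : ℂ) := by
  have hT := integrable_onTriangles hg
  set J : ℝ × ℝ × ℝ → ℝ := fun q =>
    besselJ 0 (thirdSide (q.1 * t.1) (q.2.1 * t.2.1) (q.2.2 - t.2.2)) with hJ
  have hJc : Continuous J :=
    continuous_besselJ_zero.comp (continuous_thirdSide (by fun_prop) (by fun_prop) (by fun_prop))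
  have hF : Integrable (fun q => J q * onTriangles g q) sidesMeasure :=
    hT.bdd_mul (c := 1) hJc.aestronglyMeasurable (ae_of_all _ fun q => abs_besselJ_zero_le _)
  obtain ⟨hF1, hF2⟩ := integral_sidesMeasure hF
  -- Changing `η` to `-η` preserves the sides and turns `w₋` into `w₊`.
  have hfold : (fun q : ℝ × ℝ × ℝ => (J q * onTriangles g q +
      J (q.1, q.2.1, -q.2.2) * onTriangles g (q.1, q.2.1, -q.2.2)) * (q.1 * q.2.1)) =
      fun q => besselKernel q t * onTriangles g q * (q.1 * q.2.1) := by
    funext q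
    have h1 : onTriangles g (q.1, q.2.1, -q.2.2) = onTriangles g q := by
      simp only [onTriangles, thirdSide_neg_angle]
    have h2 : J (q.1, q.2.1, -q.2.2) =
        besselJ 0 (thirdSide (q.1 * t.1) (q.2.1 * t.2.1) (q.2.2 + t.2.2)) := by
      simp only [hJ]
      rw [show -q.2.2 - t.2.2 = -(q.2.2 + t.2.2) by ring, thirdSide_neg_angle]
    rw [h1, h2, besselKernel]
    simp only [hJ]
    ring
  rw [hfold] at hF1 hF2
  refine ⟨hF1, ?_⟩
  rw [← hF2]
  set E : Plane × Plane → ℂ := fun p =>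
    Complex.exp (Complex.I * (pairInner (trianglePoint (t, α)) p : ℂ)) with hE
  have hEc : Continuous E := by
    have : Continuous fun p => pairInner (trianglePoint (t, α)) p :=
      continuous_pairInner.comp (by fun_prop : Continuous fun p => (trianglePoint (t, α), p))
    fun_prop
  have hI : Integrable (fun p => E p * (onPairs g p : ℂ)) :=
    hg.ofReal.bdd_mul (c := 1) hEc.aestronglyMeasurable
      (ae_of_all _ fun p => (norm_exp_I_mul_ofReal _).le)
  have hI2 := measurePreserving_trianglePoint.integrable_comp_of_integrable hI
  have hae : (fun p => E p * (onPairs g p : ℂ)) ∘ trianglePoint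
      =ᵐ[sidesMeasure.prod angleMeasure]
      fun p => E (trianglePoint p) * (onTriangles g p.1 : ℂ) := by
    filter_upwards [ae_onPairs_trianglePoint g] with p hp
    rw [Function.comp_apply, hp]
  calc ∫ p, E p * (onPairs g p : ℂ)
      = ∫ p, E (trianglePoint p) * (onTriangles g p.1 : ℂ) ∂(sidesMeasure.prod angleMeasure) := by
        rw [← integral_congr_ae hae, ← measurePreserving_trianglePoint.map_eq]
        refine integral_map measurePreserving_trianglePoint.measurable.aemeasurable ?_
        rw [measurePreserving_trianglePoint.map_eq]
        exact hI.aestronglyMeasurable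
    _ = ∫ q, ∫ β, E (trianglePoint (q, β)) * (onTriangles g q : ℂ) ∂angleMeasure
          ∂sidesMeasure := integral_prod _ (hI2.congr hae)
    _ = ∫ q, ((2 * Real.pi * (J q * onTriangles g q) : ℝ) : ℂ) ∂sidesMeasure := by
        congr 1
        funext q
        rw [integral_mul_const]
        simp only [hE]
        rw [integral_exp_pairInner_trianglePoint]
        push_cast
        ring
    _ = _ := by rw [integral_complex_ofReal, integral_const_mul]

/-! ### Gaussian summability and uniqueness of the Fourier transform -/

instance : (volume : Measure (Plane × Plane)).IsAddHaarMeasure :=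
  inferInstanceAs ((volume : Measure Plane).prod volume).IsAddHaarMeasure

instance : (volume : Measure (Plane × Plane)).Regular := inferInstance

instance : (volume : Measure (Plane × Plane)).InnerRegularCompactLTTop := inferInstance

instance : (volume : Measure (Plane × Plane)).IsNegInvariant :=
  Measure.IsAddHaarMeasure.isNegInvariant_of_regular _

/-- A Gaussian weight on pairs of points of the plane. -/
noncomputable def gaussWeight (b : ℝ) (z : Plane × Plane) : ℝ :=
  Real.exp (-b * ‖z.1‖ ^ 2) * Real.exp (-b * ‖z.2‖ ^ 2)

lemma continuous_gaussWeight (b : ℝ) : Continuous (gaussWeight b) := by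
  unfold gaussWeight; fun_prop

lemma gaussWeight_pos (b : ℝ) (z : Plane × Plane) : 0 < gaussWeight b z := by
  unfold gaussWeight; positivity

lemma gaussWeight_le_one {b : ℝ} (hb : 0 ≤ b) (z : Plane × Plane) : gaussWeight b z ≤ 1 := by
  unfold gaussWeight
  refine mul_le_one₀ ?_ (by positivity) ?_ <;>
  · rw [Real.exp_le_one_iff, neg_mul, neg_nonpos]; positivity

lemma integrable_exp_neg_mul_sq_norm {b : ℝ} (hb : 0 < b) :
    Integrable fun v : Plane => Real.exp (-b * ‖v‖ ^ 2) := by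
  have h := (GaussianFourier.integrable_cexp_neg_mul_sq_norm_add (V := Plane) (b := b)
    (by simpa using hb) 0 0).norm
  refine h.congr (ae_of_all _ fun v => ?_)
  simp only [zero_mul, add_zero, Complex.norm_exp]
  congr 1
  norm_cast

lemma integrable_gaussWeight {b : ℝ} (hb : 0 < b) : Integrable (gaussWeight b) :=
  (integrable_exp_neg_mul_sq_norm hb).mul_prod (integrable_exp_neg_mul_sq_norm hb)

lemma integral_gaussWeight_mul_exp {b : ℝ} (hb : 0 < b) (h : Plane × Plane) :
    ∫ z, (gaussWeight b z : ℂ) * Complex.exp (Complex.I * (pairInner z h : ℂ)) =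
      (((Real.pi / b) ^ 2 * gaussWeight (1 / (4 * b)) h : ℝ) : ℂ) := by
  have hP (c : ℂ) (w : Plane) := GaussianFourier.integral_cexp_neg_mul_sq_norm_add (V := Plane)
    (b := b) (by simpa using hb) c w
  have hsplit (z : Plane × Plane) :
      (gaussWeight b z : ℂ) * Complex.exp (Complex.I * (pairInner z h : ℂ)) =
      Complex.exp (-b * ‖z.1‖ ^ 2 + Complex.I * (inner ℝ h.1 z.1 : ℝ)) *
      Complex.exp (-b * ‖z.2‖ ^ 2 + (-Complex.I) * (inner ℝ h.2 z.2 : ℝ)) := by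
    rw [gaussWeight, pairInner, real_inner_comm h.1, real_inner_comm h.2]
    push_cast
    rw [← Complex.exp_add, ← Complex.exp_add, ← Complex.exp_add]
    congr 1
    ring
  simp only [hsplit]
  rw [Measure.volume_eq_prod,
    integral_prod_mul (fun v : Plane => Complex.exp (-b * ‖v‖ ^ 2 + Complex.I * (inner ℝ h.1 v : ℝ)))
      (fun v : Plane => Complex.exp (-b * ‖v‖ ^ 2 + (-Complex.I) * (inner ℝ h.2 v : ℝ))),
    hP, hP, gaussWeight, finrank_euclideanSpace_fin]
  push_cast
  rw [div_self two_ne_zero, Complex.cpow_one, neg_sq, Complex.I_sq]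
  have hb' : (b : ℂ) ≠ 0 := by exact_mod_cast hb.ne'
  rw [show (-1 * (‖h.1‖ : ℂ) ^ 2 / (4 * b)) = -(1 / (4 * b)) * ‖h.1‖ ^ 2 by ring,
    show (-1 * (‖h.2‖ : ℂ) ^ 2 / (4 * b)) = -(1 / (4 * b)) * ‖h.2‖ ^ 2 by ring]
  ring

/-- The Fourier transform on pairs of points of the plane. -/
noncomputable def pairFourier (f : Plane × Plane → ℂ) (z : Plane × Plane) : ℂ :=
  ∫ p, Complex.exp (Complex.I * (pairInner z p : ℂ)) * f p

/-- The Gaussian means of the inverse Fourier integral of `F`. -/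
noncomputable def gaussInverse (F : Plane × Plane → ℂ) (b : ℝ) (q : Plane × Plane) : ℂ :=
  (2 * Real.pi : ℂ)⁻¹ ^ 4 *
    ∫ z, Complex.exp (-(Complex.I * (pairInner z q : ℂ))) * ((gaussWeight b z : ℂ) * F z)

/-- The normalised Gaussian on pairs of points of the plane. -/
noncomputable def gaussBump (z : Plane × Plane) : ℝ := (Real.pi ^ 2)⁻¹ * gaussWeight 1 z

lemma gaussBump_nonneg (z : Plane × Plane) : 0 ≤ gaussBump z :=
  mul_nonneg (by positivity) (gaussWeight_pos _ _).le

lemma continuous_gaussBump : Continuous gaussBump := continuous_const.mul (continuous_gaussWeight 1)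

lemma integral_gaussBump : ∫ z, gaussBump z = 1 := by
  have h := integral_gaussWeight_mul_exp one_pos 0
  have h0 (z : Plane × Plane) : pairInner z 0 = 0 := by simp [pairInner]
  simp only [h0, Complex.ofReal_zero, mul_zero, Complex.exp_zero, mul_one] at h
  rw [integral_complex_ofReal] at h
  have h' := Complex.ofReal_injective h
  simp only [gaussBump]
  rw [integral_const_mul, h']
  have := Real.pi_ne_zero
  simp [gaussWeight]

lemma integrable_gaussBump : Integrable gaussBump :=
  (integrable_gaussWeight one_pos).const_mul _

/-- Decay required of an approximate identity at a point of continuity. The product carries the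
maximum norm, and its square is at most the sum of squares in the Gaussian. -/
lemma tendsto_pow_mul_gaussBump :
    Tendsto (fun z : Plane × Plane => ‖z‖ ^ Module.finrank ℝ (Plane × Plane) * gaussBump z)
      (Bornology.cobounded _) (𝓝 0) := by
  have hfin : Module.finrank ℝ (Plane × Plane) = 4 := by simp
  have h1 : Tendsto (fun z : Plane × Plane => ‖z‖ ^ 2) (Bornology.cobounded _) atTop :=
    (tendsto_pow_atTop two_ne_zero).comp tendsto_norm_cobounded_atTop
  have h2 := ((Real.tendsto_pow_mul_exp_neg_atTop_nhds_zero 2).comp h1).const_mul (Real.pi ^ 2)⁻¹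
  rw [mul_zero] at h2
  refine squeeze_zero (fun z => mul_nonneg (by positivity) (gaussBump_nonneg z)) (fun z => ?_) h2
  rw [hfin, gaussBump, gaussWeight, ← Real.exp_add]
  simp only [Function.comp_apply]
  have hle : Real.exp (-1 * ‖z.1‖ ^ 2 + -1 * ‖z.2‖ ^ 2) ≤ Real.exp (-‖z‖ ^ 2) := by
    refine Real.exp_le_exp.2 ?_
    rw [Prod.norm_def]
    rcases max_choice ‖z.1‖ ‖z.2‖ with h | h <;> rw [h] <;> nlinarith [sq_nonneg ‖z.1‖, sq_nonneg ‖z.2‖]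
  calc _ = (Real.pi ^ 2)⁻¹ * ((‖z‖ ^ 2) ^ 2 * Real.exp (-1 * ‖z.1‖ ^ 2 + -1 * ‖z.2‖ ^ 2)) := by ring
    _ ≤ _ := by gcongr

/-- The convolution of `f` with a Gaussian of width `1 / c`. -/
noncomputable def gaussMean (f : Plane × Plane → ℂ) (c : ℝ) (q : Plane × Plane) : ℂ :=
  ∫ p, (c ^ 4 * gaussBump (c • (q - p))) • f p

lemma gaussInverse_pairFourier {f : Plane × Plane → ℂ} (hf : Integrable f) {c : ℝ} (hc : 0 < c)
    (q : Plane × Plane) :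
    gaussInverse (pairFourier f) (1 / (4 * c ^ 2)) q = gaussMean f c q := by
  -- The transform of a Gaussian of exponent `b` has exponent `1 / (4b)`, which is `c²` for this
  -- `b`.
  set b := 1 / (4 * c ^ 2) with hbdef
  have hb : 0 < b := by positivity
  have hb4 : 1 / (4 * b) = c ^ 2 := by rw [hbdef]; field_simp
  have hE (z p : Plane × Plane) : Complex.exp (-(Complex.I * (pairInner z q : ℂ))) *
      ((gaussWeight b z : ℂ) * (Complex.exp (Complex.I * (pairInner z p : ℂ)) * f p)) =
      (gaussWeight b z : ℂ) * Complex.exp (Complex.I * (pairInner z (p - q) : ℂ)) * f p := by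
    have : pairInner z (p - q) = pairInner z p - pairInner z q := by
      simp only [pairInner, Prod.fst_sub, Prod.snd_sub, inner_sub_right]; ring
    rw [this]
    push_cast
    rw [mul_sub, sub_eq_add_neg, Complex.exp_add]
    ring
  -- The Gaussian makes the integrand jointly integrable, so Fubini applies although the transform
  -- of `f` need not be integrable.
  have hint : Integrable (fun x : (Plane × Plane) × (Plane × Plane) =>
      (gaussWeight b x.1 : ℂ) * Complex.exp (Complex.I * (pairInner x.1 (x.2 - q) : ℂ)) * f x.2)
      (volume.prod volume) := by
    have h1 := ((integrable_gaussWeight hb).ofReal (𝕜 := ℂ)).mul_prod hf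
    have hc : Continuous fun x : (Plane × Plane) × (Plane × Plane) =>
        Complex.exp (Complex.I * (pairInner x.1 (x.2 - q) : ℂ)) := by
      have := continuous_pairInner.comp (by fun_prop :
        Continuous fun x : (Plane × Plane) × (Plane × Plane) => (x.1, x.2 - q))
      simp only [Function.comp_def] at this
      fun_prop
    have h2 := h1.bdd_mul (c := 1) hc.aestronglyMeasurable
      (ae_of_all _ fun x => (norm_exp_I_mul_ofReal _).le)
    refine h2.congr (ae_of_all _ fun x => ?_)
    simp only
    rw [RCLike.ofReal_eq_complex_ofReal]
    ring
  calc gaussInverse (pairFourier f) b q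
      = (2 * Real.pi : ℂ)⁻¹ ^ 4 * ∫ z, ∫ p, (gaussWeight b z : ℂ) *
          Complex.exp (Complex.I * (pairInner z (p - q) : ℂ)) * f p := by
        simp only [gaussInverse, pairFourier, ← integral_const_mul, hE]
    _ = (2 * Real.pi : ℂ)⁻¹ ^ 4 * ∫ p, ∫ z, (gaussWeight b z : ℂ) *
          Complex.exp (Complex.I * (pairInner z (p - q) : ℂ)) * f p := by
        rw [integral_integral_swap hint]
    _ = _ := by
        rw [gaussMean, ← integral_const_mul]
        congr 1
        funext p
        rw [integral_mul_const, integral_gaussWeight_mul_exp hb, hb4, Complex.real_smul, ← mul_assoc]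
        congr 1
        have hw : gaussWeight (c ^ 2) (p - q) = gaussWeight 1 (c • (q - p)) := by
          simp only [gaussWeight, Prod.fst_sub, Prod.snd_sub, Prod.smul_fst, Prod.smul_snd, norm_smul,
            Real.norm_of_nonneg hc.le, norm_sub_rev q.1, norm_sub_rev q.2]
          ring_nf
        rw [gaussBump, ← hw, hbdef]
        have hp : (Real.pi : ℂ) ≠ 0 := by exact_mod_cast Real.pi_ne_zero
        push_cast
        field_simp
        norm_num

theorem tendsto_gaussMean_of_continuousAt {f : Plane × Plane → ℂ} (hf : Integrable f)
    {q : Plane × Plane} (hq : ContinuousAt f q) :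
    Tendsto (fun c => gaussMean f c q) atTop (𝓝 (f q)) := by
  have h := tendsto_integral_comp_smul_smul_of_integrable' (μ := (volume : Measure (Plane × Plane)))
    gaussBump_nonneg integral_gaussBump tendsto_pow_mul_gaussBump hf hq
  have hfin : Module.finrank ℝ (Plane × Plane) = 4 := by simp
  rwa [hfin] at h

lemma gaussMean_eq (f : Plane × Plane → ℂ) {c : ℝ} (hc : 0 < c) (q : Plane × Plane) :
    gaussMean f c q = ∫ h, gaussBump h • f (q - c⁻¹ • h) := by
  have h1 := Measure.integral_comp_smul (volume : Measure (Plane × Plane))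
    (fun h => (c ^ 4 * gaussBump h) • f (q - c⁻¹ • h)) c
  have h2 := integral_sub_left_eq_self
    (fun h => (c ^ 4 * gaussBump (c • h)) • f (q - c⁻¹ • (c • h))) (volume : Measure (Plane × Plane)) q
  have h3 (p : Plane × Plane) : q - c⁻¹ • c • (q - p) = p := by
    rw [inv_smul_smul₀ hc.ne', sub_sub_cancel]
  simp only [h3] at h2
  rw [gaussMean, h2, h1, show Module.finrank ℝ (Plane × Plane) = 4 by simp,
    abs_of_pos (by positivity), ← integral_smul]
  congr 1
  funext h
  rw [smul_smul, inv_mul_cancel_left₀ (by positivity)]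

/-- Translation is continuous in `L¹`. -/
lemma tendsto_lintegral_translate_sub {f : Plane × Plane → ℂ} (hf : Integrable f) :
    Tendsto (fun h => ∫⁻ q, ‖f (q - h) - f q‖ₑ) (𝓝 0) (𝓝 0) := by
  have hf1 : MemLp f 1 := memLp_one_iff_integrable.2 hf
  set F := hf1.toLp f
  have : Fact ((1 : ENNReal) ≠ ⊤) := ⟨ENNReal.one_ne_top⟩
  have h1 : Continuous fun h : Plane × Plane => edist ((DomAddAct.mk (-h)) +ᵥ F) F := by
    have : Continuous fun h : Plane × Plane => (DomAddAct.mk (-h)) := by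
      exact DomAddAct.continuous_mk.comp continuous_neg
    exact (this.vadd continuous_const).edist continuous_const
  have h2 := h1.tendsto 0
  convert h2 using 1
  · funext h
    rw [DomAddAct.mk_vadd_toLp, Lp.edist_toLp_toLp, eLpNorm_one_eq_lintegral_enorm]
    refine lintegral_congr fun q => ?_
    simp only [Pi.sub_apply, vadd_eq_add, neg_add_eq_sub]
  · simp

/-- The `L¹` error is at most the Gaussian average of the `L¹` distance between `f` and its
translate by `c⁻¹h`. This distance tends to zero and never exceeds twice the norm of `f`. -/
theorem tendsto_lintegral_gaussMean_sub {f : Plane × Plane → ℂ} (hfm : StronglyMeasurable f)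
    (hf : Integrable f) :
    Tendsto (fun c => ∫⁻ q, ‖gaussMean f c q - f q‖ₑ) atTop (𝓝 0) := by
  set D : Plane × Plane → ENNReal := fun h => ∫⁻ q, ‖f (q - h) - f q‖ₑ with hD
  have hDm : Measurable D := by
    have : Measurable fun x : (Plane × Plane) × (Plane × Plane) => ‖f (x.2 - x.1) - f x.2‖ₑ :=
      ((hfm.measurable.comp (measurable_snd.sub measurable_fst)).sub
        (hfm.measurable.comp measurable_snd)).enorm
    exact this.lintegral_prod_right'
  have hDle (h) : D h ≤ 2 * ∫⁻ q, ‖f q‖ₑ := by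
    calc D h ≤ ∫⁻ q, (‖f (q - h)‖ₑ + ‖f q‖ₑ) := lintegral_mono fun q => enorm_sub_le
      _ = 2 * ∫⁻ q, ‖f q‖ₑ := by
        rw [lintegral_add_right _ hfm.measurable.enorm,
          lintegral_sub_right_eq_self (fun q => ‖f q‖ₑ), two_mul]
  have hbound (c : ℝ) (hc : 0 < c) : ∫⁻ q, ‖gaussMean f c q - f q‖ₑ ≤
      ∫⁻ h, ‖gaussBump h‖ₑ * D (c⁻¹ • h) := by
    calc ∫⁻ q, ‖gaussMean f c q - f q‖ₑ
        ≤ ∫⁻ q, ∫⁻ h, ‖gaussBump h‖ₑ * ‖f (q - c⁻¹ • h) - f q‖ₑ := by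
          refine lintegral_mono fun q => ?_
          have i1 : Integrable fun h => gaussBump h • f (q - c⁻¹ • h) := by
            have j1 : Integrable fun h => f (q - c⁻¹ • h) :=
              (hf.comp_sub_left q).comp_smul (inv_ne_zero hc.ne')
            refine j1.bdd_smul ((Real.pi ^ 2)⁻¹) continuous_gaussBump.aestronglyMeasurable
              (ae_of_all _ fun h => ?_)
            rw [Real.norm_of_nonneg (gaussBump_nonneg h), gaussBump]
            exact mul_le_of_le_one_right (by positivity) (gaussWeight_le_one zero_le_one h)
          have i2 : Integrable fun h => gaussBump h • f q := integrable_gaussBump.smul_const _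
          have e : gaussMean f c q - f q = ∫ h, gaussBump h • (f (q - c⁻¹ • h) - f q) := by
            simp only [smul_sub]
            rw [integral_sub i1 i2, ← gaussMean_eq f hc, integral_smul_const, integral_gaussBump,
              one_smul]
          rw [e]
          refine (enorm_integral_le_lintegral_enorm _).trans (le_of_eq ?_)
          simp only [enorm_smul]
      _ = ∫⁻ h, ∫⁻ q, ‖gaussBump h‖ₑ * ‖f (q - c⁻¹ • h) - f q‖ₑ := by
          refine lintegral_lintegral_swap (Measurable.aemeasurable ?_)
          have := hfm.measurable
          have := continuous_gaussBump.measurable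
          unfold Function.uncurry
          fun_prop
      _ = ∫⁻ h, ‖gaussBump h‖ₑ * D (c⁻¹ • h) := by
          refine lintegral_congr fun h => ?_
          rw [lintegral_const_mul]
          have := hfm.measurable
          fun_prop
  have hlim : Tendsto (fun c : ℝ => ∫⁻ h, ‖gaussBump h‖ₑ * D (c⁻¹ • h)) atTop
      (𝓝 (∫⁻ _ : Plane × Plane, 0)) := by
    refine tendsto_lintegral_filter_of_dominated_convergence
      (fun h => ‖gaussBump h‖ₑ * (2 * ∫⁻ q, ‖f q‖ₑ)) (Eventually.of_forall fun c => ?_)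
      (Eventually.of_forall fun c => ae_of_all _ fun h => by gcongr; exact hDle _) ?_
      (ae_of_all _ fun h => ?_)
    · have := continuous_gaussBump.measurable
      fun_prop
    · rw [lintegral_mul_const _ continuous_gaussBump.measurable.enorm]
      exact ENNReal.mul_ne_top integrable_gaussBump.2.ne
        (ENNReal.mul_ne_top (by simp) hf.2.ne)
    · have h1 : Tendsto (fun c : ℝ => c⁻¹ • h) atTop (𝓝 0) := by
        simpa using (tendsto_inv_atTop_zero (𝕜 := ℝ)).smul_const h
      have h2 := (tendsto_lintegral_translate_sub hf).comp h1
      have h3 := ENNReal.Tendsto.const_mul (a := ‖gaussBump h‖ₑ) h2 (Or.inr (by simp))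
      simpa using h3
  rw [lintegral_zero] at hlim
  refine tendsto_of_tendsto_of_tendsto_of_le_of_le' tendsto_const_nhds hlim
    (Eventually.of_forall fun _ => zero_le) ?_
  filter_upwards [eventually_gt_atTop 0] with c hc using hbound c hc

/-- Convergence in `L¹` gives convergence in measure, hence almost everywhere along a subsequence.
One sequence suffices to identify a limit known to exist. -/
theorem exists_seq_tendsto_ae_gaussMean {f : Plane × Plane → ℂ} (hf : Integrable f) :
    ∃ s : ℕ → ℝ, (∀ n, 0 < s n) ∧ Tendsto s atTop atTop ∧
      ∀ᵐ q, Tendsto (fun n => gaussMean f (s n) q) atTop (𝓝 (f q)) := by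
  set f' := hf.1.mk f with hf'
  have hfm : StronglyMeasurable f' := hf.1.stronglyMeasurable_mk
  have hae : f =ᵐ[volume] f' := hf.1.ae_eq_mk
  have hfi : Integrable f' := hf.congr hae
  have hmean : gaussMean f = gaussMean f' := by
    funext c q
    refine integral_congr_ae ?_
    filter_upwards [hae] with p hp
    rw [hp]
  have hs : Tendsto (fun n : ℕ => (n : ℝ) + 1) atTop atTop :=
    tendsto_atTop_add_const_right _ _ tendsto_natCast_atTop_atTop
  have hmeas (c : ℝ) : StronglyMeasurable (gaussMean f' c) := by
    have : StronglyMeasurable fun x : (Plane × Plane) × (Plane × Plane) =>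
        (c ^ 4 * gaussBump (c • (x.1 - x.2))) • f' x.2 := by
      have h1 := hfm.measurable
      have := continuous_gaussBump.measurable
      refine Measurable.stronglyMeasurable ?_
      fun_prop
    exact this.integral_prod_right'
  have hL := (tendsto_lintegral_gaussMean_sub hfm hfi).comp hs
  have hm : TendstoInMeasure volume (fun (n : ℕ) => gaussMean f' ((n : ℝ) + 1)) atTop f' := by
    refine tendstoInMeasure_of_tendsto_eLpNorm one_ne_zero
      (fun n => (hmeas _).aestronglyMeasurable) hfm.aestronglyMeasurable ?_
    refine hL.congr fun n => ?_
    rw [eLpNorm_one_eq_lintegral_enorm]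
    rfl
  obtain ⟨ns, hns, h⟩ := hm.exists_seq_tendsto_ae
  refine ⟨fun n => (ns n : ℝ) + 1, fun n => by positivity, hs.comp hns.tendsto_atTop, ?_⟩
  filter_upwards [hae, h] with q hq h
  rw [hmean, hq]
  exact h

/-- An integrable function is determined by its Fourier transform. -/
theorem ae_eq_of_pairFourier_eq {f g : Plane × Plane → ℂ} (hf : Integrable f) (hg : Integrable g)
    (h : pairFourier f = pairFourier g) : f =ᵐ[volume] g := by
  have hfg := hf.sub hg
  obtain ⟨s, hs, -, hlim⟩ := exists_seq_tendsto_ae_gaussMean hfg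
  have h0 : pairFourier (f - g) = 0 := by
    funext z
    have hE : Continuous fun p => Complex.exp (Complex.I * (pairInner z p : ℂ)) := by
      have : Continuous fun p => pairInner z p :=
        continuous_pairInner.comp (by fun_prop : Continuous fun p => (z, p))
      fun_prop
    have hb {k : Plane × Plane → ℂ} (hk : Integrable k) :
        Integrable fun p => Complex.exp (Complex.I * (pairInner z p : ℂ)) * k p :=
      hk.bdd_mul (c := 1) hE.aestronglyMeasurable
        (ae_of_all _ fun p => (norm_exp_I_mul_ofReal _).le)
    have h1 := congrFun h z
    simp only [pairFourier, Pi.sub_apply, mul_sub, Pi.zero_apply] at h1 ⊢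
    rw [integral_sub (hb hf) (hb hg), h1, sub_self]
  filter_upwards [hlim] with q hq
  have h1 (n : ℕ) : gaussMean (f - g) (s n) q = 0 := by
    rw [← gaussInverse_pairFourier hfg (hs n), h0, gaussInverse]
    simp
  simp only [h1] at hq
  have := tendsto_nhds_unique hq tendsto_const_nhds
  exact sub_eq_zero.1 this

/-! ### Invariance of the third-order cumulant -/

section Field

variable {Ω : Type*} [MeasurableSpace Ω] {P : Measure Ω} {X : Plane → Ω → ℝ}

lemma cum3_eq_integral (hX : IsHomogeneousIsotropicField P X) (x : Fin 3 → Plane) :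
    cum3 P (X (x 0)) (X (x 1)) (X (x 2)) = ∫ ω, X (x 0) ω * X (x 1) ω * X (x 2) ω ∂P := by
  simp only [cum3, hX.mean_zero, sub_zero]

lemma integral_triple_eq {x y : Fin 3 → Plane}
    (h : IdentDistrib (fun ω i => X (x i) ω) (fun ω i => X (y i) ω) P P) :
    ∫ ω, X (x 0) ω * X (x 1) ω * X (x 2) ω ∂P = ∫ ω, X (y 0) ω * X (y 1) ω * X (y 2) ω ∂P :=
  (h.comp (u := fun v : Fin 3 → ℝ => v 0 * v 1 * v 2) (by fun_prop)).integral_eq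

lemma cum3_add (hX : IsHomogeneousIsotropicField P X) (x₁ x₂ x₃ h : Plane) :
    cum3 P (X (x₁ + h)) (X (x₂ + h)) (X (x₃ + h)) = cum3 P (X x₁) (X x₂) (X x₃) := by
  have e := integral_triple_eq (hX.homogeneous 3 ![x₁, x₂, x₃] h)
  rw [← cum3_eq_integral hX ![x₁, x₂, x₃],
    ← cum3_eq_integral hX (fun i => ![x₁, x₂, x₃] i + h)] at e
  exact e

lemma cum3_planeRotation (hX : IsHomogeneousIsotropicField P X) (x₁ x₂ x₃ : Plane) (γ : ℝ) :
    cum3 P (X (planeRotation γ x₁)) (X (planeRotation γ x₂)) (X (planeRotation γ x₃)) =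
      cum3 P (X x₁) (X x₂) (X x₃) := by
  have e := integral_triple_eq (hX.isotropic 3 ![x₁, x₂, x₃] γ)
  rw [← cum3_eq_integral hX ![x₁, x₂, x₃],
    ← cum3_eq_integral hX (fun i => planeRotation γ (![x₁, x₂, x₃] i))] at e
  exact e

end Field

/-! ### Invariant functions of two vectors -/

/-- The diagonal action of a plane isometry on pairs of points. -/
noncomputable def pairMap (e : Plane ≃ₗᵢ[ℝ] Plane) (p : Plane × Plane) : Plane × Plane :=
  (e p.1, e p.2)

lemma measurePreserving_pairMap (e : Plane ≃ₗᵢ[ℝ] Plane) :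
    MeasurePreserving (pairMap e) volume volume :=
  e.measurePreserving.prod e.measurePreserving

lemma measurableEmbedding_pairMap (e : Plane ≃ₗᵢ[ℝ] Plane) : MeasurableEmbedding (pairMap e) :=
  (MeasurableEquiv.prodCongr e.toMeasurableEquiv e.toMeasurableEquiv).measurableEmbedding

lemma pairInner_pairMap (e : Plane ≃ₗᵢ[ℝ] Plane) (z p : Plane × Plane) :
    pairInner (pairMap e z) (pairMap e p) = pairInner z p := by
  simp only [pairInner, pairMap, LinearIsometryEquiv.inner_map_map]

lemma pairFourier_comp_pairMap (e : Plane ≃ₗᵢ[ℝ] Plane) (f : Plane × Plane → ℂ)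
    (z : Plane × Plane) :
    pairFourier (f ∘ pairMap e) z = pairFourier f (pairMap e z) := by
  rw [pairFourier, pairFourier, ← (measurePreserving_pairMap e).integral_comp
    (measurableEmbedding_pairMap e)
    (fun p => Complex.exp (Complex.I * (pairInner (pairMap e z) p : ℂ)) * f p)]
  simp only [pairInner_pairMap, Function.comp_apply]

/-- A function of two points of the plane that is invariant under rotations and a reflection is a
function of the sides of the triangle they span with the origin. -/
theorem exists_eq_onPairs {f : Plane × Plane → ℝ}
    (hrot : ∀ γ p, f (pairMap (planeRotationEquiv γ) p) = f p)
    (hmir : ∀ p, f (pairMap planeMirrorEquiv p) = f p) : ∃ g, f = onPairs g := by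
  set sides : Plane × Plane → ℝ × ℝ × ℝ := fun p => (‖p.1 - p.2‖, ‖p.1‖, ‖p.2‖)
  have hfac : f.FactorsThrough sides := by
    intro p p' h
    simp only [sides, Prod.mk.injEq] at h
    obtain ⟨γ, ⟨h1, h2⟩ | ⟨h1, h2⟩⟩ := exists_planeRotation_of_norm_eq h.2.1 h.2.2 h.1
    · rw [← hrot γ p]
      exact congrArg f (Prod.ext h1 h2)
    · rw [← hmir p, ← hrot γ]
      exact congrArg f (Prod.ext h1 h2)
  -- The default value `0` is taken only at triples that are not the sides of a triangle.
  refine ⟨fun r₁ r₂ r₃ => Function.extend sides f 0 (r₁, r₂, r₃), ?_⟩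
  funext p
  exact (hfac.extend_apply 0 p).symm

lemma pairMap_rotation_rotation (γ δ : ℝ) (p : Plane × Plane) :
    pairMap (planeRotationEquiv γ) (pairMap (planeRotationEquiv δ) p) =
      pairMap (planeRotationEquiv (γ + δ)) p := by
  have (x : Plane) : planeRotation γ (planeRotation δ x) = planeRotation (γ + δ) x :=
    plane_ext (by simp [Real.cos_add, Real.sin_add]; ring)
      (by simp [Real.cos_add, Real.sin_add]; ring)
  exact Prod.ext (this _) (this _)

lemma pairMap_mirror_rotation (γ : ℝ) (p : Plane × Plane) :
    pairMap planeMirrorEquiv (pairMap (planeRotationEquiv γ) p) =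
      pairMap (planeRotationEquiv (-γ)) (pairMap planeMirrorEquiv p) := by
  have (x : Plane) : planeMirror (planeRotation γ x) = planeRotation (-γ) (planeMirror x) :=
    plane_ext (by simp) (by simp; ring)
  exact Prod.ext (this _) (this _)

lemma pairMap_mirror_mirror (p : Plane × Plane) :
    pairMap planeMirrorEquiv (pairMap planeMirrorEquiv p) = p := by
  have (x : Plane) : planeMirror (planeMirror x) = x := plane_ext (by simp) (by simp)
  exact Prod.ext (this _) (this _)

lemma measurable_pairMap_rotation : Measurable fun x : ℝ × (Plane × Plane) =>
    pairMap (planeRotationEquiv x.1) x.2 := by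
  have h1 : Continuous fun x : ℝ × Plane => planeRotation x.1 x.2 := by
    unfold planeRotation
    refine (PiLp.continuous_toLp 2 _).comp (continuous_pi fun i => ?_)
    fin_cases i
    · simp; fun_prop
    · simp; fun_prop
  have h2 {g : ℝ × (Plane × Plane) → Plane} (hg : Continuous g) :
      Measurable fun x : ℝ × (Plane × Plane) => planeRotation x.1 (g x) :=
    (h1.comp (continuous_fst.prodMk hg)).measurable
  exact (h2 (g := fun x => x.2.1) (by fun_prop)).prodMk (h2 (g := fun x => x.2.2) (by fun_prop))

/-- The exceptional null set may depend on the rotation. Averaging over all rotations, then over the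
mirror, gives an exactly invariant function; by Fubini it agrees with `f` almost everywhere. -/
theorem exists_ae_eq_onPairs_of_ae_invariant {f : Plane × Plane → ℝ} (hfm : Measurable f)
    (hrot : ∀ γ, ∀ᵐ p, f (pairMap (planeRotationEquiv γ) p) = f p)
    (hmir : ∀ᵐ p, f (pairMap planeMirrorEquiv p) = f p) :
    ∃ g, ∀ᵐ p, f p = onPairs g p := by
  set B : Plane × Plane → ℝ := fun p =>
    (2 * Real.pi)⁻¹ * ∫ γ in (0 : ℝ)..(2 * Real.pi), f (pairMap (planeRotationEquiv γ) p)
  -- This holds at every `p`, even where the integral has its default value, because it only shifts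
  -- a periodic integrand.
  have hBrot (δ : ℝ) (p) : B (pairMap (planeRotationEquiv δ) p) = B p := by
    simp only [B, pairMap_rotation_rotation]
    congr 1
    have hper : Function.Periodic
        (fun γ : ℝ => f (pairMap (planeRotationEquiv γ) p)) (2 * Real.pi) := by
      intro γ
      have (x : Plane) : planeRotation (γ + 2 * Real.pi) x = planeRotation γ x :=
        plane_ext (by simp) (by simp)
      have h2 : pairMap (planeRotationEquiv (γ + 2 * Real.pi)) p =
          pairMap (planeRotationEquiv γ) p := Prod.ext (this _) (this _)
      simp only [h2]
    rw [intervalIntegral.integral_comp_add_right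
      (fun γ : ℝ => f (pairMap (planeRotationEquiv γ) p)), zero_add, add_comm _ δ]
    have := hper.intervalIntegral_add_eq δ 0
    rwa [zero_add] at this
  have hBae : ∀ᵐ p, B p = f p := by
    have h1 : ∀ᵐ γ ∂(volume.restrict (Set.Ioc 0 (2 * Real.pi))), ∀ᵐ p : Plane × Plane,
        f (pairMap (planeRotationEquiv γ) p) = f p :=
      ae_of_all _ fun γ => hrot γ
    have h2 := (Measure.ae_ae_comm
      (p := fun γ p => f (pairMap (planeRotationEquiv γ) p) = f p) (measurableSet_eq_fun (hfm.comp measurable_pairMap_rotation)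
      (hfm.comp measurable_snd))).1 h1
    filter_upwards [h2] with p hp
    simp only [B]
    rw [intervalIntegral.integral_of_le Real.two_pi_pos.le,
      integral_congr_ae (g := fun _ => f p)]
    · rw [integral_const, measureReal_restrict_apply_univ, Real.volume_real_Ioc_of_le
        Real.two_pi_pos.le, sub_zero, smul_eq_mul, inv_mul_cancel_left₀ Real.two_pi_pos.ne']
    · filter_upwards [hp] with γ hγ
      rw [hγ]
  obtain ⟨g, hg⟩ := exists_eq_onPairs
    (f := fun p => (B p + B (pairMap planeMirrorEquiv p)) / 2)
    (fun γ p => by simp only [pairMap_mirror_rotation, hBrot]) (fun p => by simp only [pairMap_mirror_mirror, add_comm])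
  refine ⟨g, ?_⟩
  have hBmir := (measurePreserving_pairMap planeMirrorEquiv).quasiMeasurePreserving.ae hBae
  filter_upwards [hBae, hBmir, hmir] with p h3 h4 h5
  rw [← hg]
  simp only [h3, h4, h5]
  ring

/-- An integrable function of two points of the plane with a real, rotation and reflection
invariant Fourier transform is a real function of the sides of a triangle. -/
theorem exists_ae_eq_onPairs {f : Plane × Plane → ℂ} (hf : Integrable f) {c : Plane × Plane → ℝ}
    (hc : ∀ z, pairFourier f z = c z)
    (hrot : ∀ γ z, c (pairMap (planeRotationEquiv γ) z) = c z)
    (hmir : ∀ z, c (pairMap planeMirrorEquiv z) = c z) :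
    ∃ g, ∀ᵐ p, f p = (onPairs g p : ℂ) := by
  set f' := hf.1.mk f
  have hfm : StronglyMeasurable f' := hf.1.stronglyMeasurable_mk
  have hae : f =ᵐ[volume] f' := hf.1.ae_eq_mk
  have hfi : Integrable f' := hf.congr hae
  have hc' (z) : pairFourier f' z = c z := by
    rw [← hc]
    refine integral_congr_ae ?_
    filter_upwards [hae] with p hp
    rw [hp]
  have hinv (e : Plane ≃ₗᵢ[ℝ] Plane) (he : ∀ z, c (pairMap e z) = c z) :
      ∀ᵐ p, f' (pairMap e p) = f' p := by
    refine ae_eq_of_pairFourier_eq (f := f' ∘ pairMap e)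
      ((measurePreserving_pairMap e).integrable_comp_of_integrable hfi) hfi ?_
    funext z
    rw [pairFourier_comp_pairMap, hc', hc', he]
  have hreal : ∀ᵐ p, f' p = ((f' p).re : ℂ) := by
    -- Conjugating a function conjugates its transform and reflects the argument. Since `-z` is `z`
    -- rotated by `π`, the real function `c` is even and the transform is unchanged.
    have hconj : (fun p => starRingEnd ℂ (f' p)) =ᵐ[volume] f' := by
      refine ae_eq_of_pairFourier_eq (Complex.conjLIE.integrable_comp_iff.2 hfi)
        hfi ?_
      funext z
      have h1 : pairFourier (fun p => starRingEnd ℂ (f' p)) z =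
          starRingEnd ℂ (pairFourier f' (-z)) := by
        rw [pairFourier, pairFourier, ← integral_conj]
        congr 1
        funext p
        have : pairInner (-z) p = -pairInner z p := by
          simp only [pairInner, Prod.fst_neg, Prod.snd_neg, inner_neg_left]; ring
        rw [map_mul, ← Complex.exp_conj, map_mul, this, Complex.conj_I, Complex.conj_ofReal]
        push_cast
        ring_nf
      have h2 : -z = pairMap (planeRotationEquiv Real.pi) z := by
        have (x : Plane) : -x = planeRotation Real.pi x := plane_ext (by simp) (by simp)
        exact Prod.ext (this _) (this _)
      rw [h1, h2, hc', hc', hrot, Complex.conj_ofReal]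
    filter_upwards [hconj] with p hp
    exact (Complex.conj_eq_iff_re.1 hp).symm
  obtain ⟨g, hg⟩ := exists_ae_eq_onPairs_of_ae_invariant (f := fun p => (f' p).re)
    (Complex.measurable_re.comp hfm.measurable)
    (fun γ => (hinv _ (hrot γ)).mono fun p hp => congrArg Complex.re hp)
    ((hinv _ hmir).mono fun p hp => congrArg Complex.re hp)
  refine ⟨g, ?_⟩
  filter_upwards [hae, hreal, hg] with p h1 h2 h3
  rw [h1, h2, h3]

/-! ### Triangle covariance and bispectral density -/

section Density

variable {Ω : Type*} [MeasurableSpace Ω] {P : Measure Ω} {X : Plane → Ω → ℝ}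

/-- The third-order covariance of the field at the origin and a pair of points. -/
noncomputable def pairCovariance (P : Measure Ω) (X : Plane → Ω → ℝ) (z : Plane × Plane) : ℝ :=
  cum3 P (X 0) (X z.1) (X z.2)

lemma cum3_eq_pairCovariance (hX : IsHomogeneousIsotropicField P X) (x₁ x₂ x₃ : Plane) :
    cum3 P (X x₁) (X x₂) (X x₃) = pairCovariance P X (x₂ - x₁, x₃ - x₁) := by
  have h := cum3_add hX 0 (x₂ - x₁) (x₃ - x₁) x₁
  rw [zero_add, sub_add_cancel, sub_add_cancel] at h
  exact h

lemma pairCovariance_rotation (hX : IsHomogeneousIsotropicField P X) (γ : ℝ) (z : Plane × Plane) :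
    pairCovariance P X (pairMap (planeRotationEquiv γ) z) = pairCovariance P X z := by
  have h := cum3_planeRotation hX 0 z.1 z.2 γ
  rw [← planeRotationEquiv_apply γ 0, map_zero] at h
  exact h

lemma pairCovariance_mirror
    (hmirror : ∀ x₁ x₂ x₃ : Plane,
      cum3 P (X (planeMirror x₁)) (X (planeMirror x₂)) (X (planeMirror x₃)) =
        cum3 P (X x₁) (X x₂) (X x₃)) (z : Plane × Plane) :
    pairCovariance P X (pairMap planeMirrorEquiv z) = pairCovariance P X z := by
  have h := hmirror 0 z.1 z.2
  rw [← planeMirrorEquiv_apply 0, map_zero] at h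
  exact h

theorem exists_isTriangleCovariance (hX : IsHomogeneousIsotropicField P X)
    (hmirror : ∀ x₁ x₂ x₃ : Plane,
      cum3 P (X (planeMirror x₁)) (X (planeMirror x₂)) (X (planeMirror x₃)) =
        cum3 P (X x₁) (X x₂) (X x₃)) : ∃ C, IsTriangleCovariance P X C := by
  obtain ⟨g, hg⟩ := exists_eq_onPairs (pairCovariance_rotation hX) (pairCovariance_mirror hmirror)
  refine ⟨g, fun x₁ x₂ x₃ => ?_⟩
  rw [cum3_eq_pairCovariance hX, hg, onPairs]
  simp only
  rw [sub_sub_sub_cancel_right, norm_sub_rev]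

lemma IsTriangleCovariance.pairCovariance_eq {C : ℝ → ℝ → ℝ → ℝ}
    (hC : IsTriangleCovariance P X C) (z : Plane × Plane) : pairCovariance P X z = onPairs C z := by
  rw [pairCovariance, hC, onPairs, sub_zero, sub_zero, norm_sub_rev]

lemma measurePreserving_neg_snd :
    MeasurePreserving (fun p : Plane × Plane => (p.1, -p.2)) volume volume :=
  (MeasurePreserving.id (volume : Measure Plane)).prod (Measure.measurePreserving_neg volume)

lemma measurableEmbedding_neg_snd :
    MeasurableEmbedding (fun p : Plane × Plane => (p.1, -p.2)) :=
  (MeasurableEquiv.prodCongr (MeasurableEquiv.refl Plane)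
    (MeasurableEquiv.neg Plane)).measurableEmbedding

/-- Changing the sign of `ω₃` makes `ω₁ = p.2 - p.1`, whose length is the side opposite the origin,
as for the covariance. -/
lemma IsBispectralDensity.pairFourier_eq {S : Plane → Plane → Plane → ℂ}
    (hS : IsBispectralDensity P X S) :
    Integrable (fun p : Plane × Plane => S (p.2 - p.1) p.1 (-p.2)) ∧
    ∀ z, pairFourier (fun p => S (p.2 - p.1) p.1 (-p.2)) z = pairCovariance P X z := by
  have he (p : Plane × Plane) : -p.1 - -p.2 = p.2 - p.1 := by abel
  refine ⟨?_, fun z => ?_⟩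
  · have h := measurePreserving_neg_snd.integrable_comp_of_integrable hS.1
    simpa only [Function.comp_def, he] using h
  · rw [pairCovariance, hS.2,
      ← measurePreserving_neg_snd.integral_comp measurableEmbedding_neg_snd, pairFourier]
    congr 1
    funext p
    simp only [he, inner_zero_left, inner_neg_right, zero_add, pairInner, sub_eq_add_neg]

theorem IsBispectralDensity.exists_ae_eq (hX : IsHomogeneousIsotropicField P X)
    (hmirror : ∀ x₁ x₂ x₃ : Plane,
      cum3 P (X (planeMirror x₁)) (X (planeMirror x₂)) (X (planeMirror x₃)) =
        cum3 P (X x₁) (X x₂) (X x₃)) {S : Plane → Plane → Plane → ℂ}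
    (hS : IsBispectralDensity P X S) :
    ∃ S₃ : ℝ → ℝ → ℝ → ℝ, ∀ᵐ p : Plane × Plane,
      S (-p.1 - p.2) p.1 p.2 = (S₃ ‖-p.1 - p.2‖ ‖p.1‖ ‖p.2‖ : ℂ) := by
  obtain ⟨hI, hF⟩ := hS.pairFourier_eq
  obtain ⟨g, hg⟩ := exists_ae_eq_onPairs hI hF (pairCovariance_rotation hX)
    (pairCovariance_mirror hmirror)
  refine ⟨g, ?_⟩
  filter_upwards [measurePreserving_neg_snd.quasiMeasurePreserving.ae hg] with p hp
  simp only [onPairs, neg_neg, norm_neg] at hp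
  rw [show -p.1 - p.2 = -p.2 - p.1 by abel, hp]
  congr 2
  rw [← norm_neg]
  congr 1
  abel

end Density

/-! ### Inversion of the transform -/

lemma norm_pairFourier_le (f : Plane × Plane → ℂ) (z : Plane × Plane) :
    ‖pairFourier f z‖ ≤ ∫ p, ‖f p‖ := by
  refine (norm_integral_le_integral_norm _).trans (le_of_eq ?_)
  simp only [norm_mul, norm_exp_I_mul_ofReal, one_mul]

lemma continuous_pairFourier {f : Plane × Plane → ℂ} (hf : Integrable f) :
    Continuous (pairFourier f) := by
  refine continuous_of_dominated (bound := fun p => ‖f p‖) (fun z => ?_) (fun z => ?_) hf.norm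
    (ae_of_all _ fun p => ?_)
  · have : Continuous fun p => pairInner z p :=
      continuous_pairInner.comp (continuous_const.prodMk continuous_id)
    have h2 : Continuous fun p => Complex.exp (Complex.I * (pairInner z p : ℂ)) := by fun_prop
    exact h2.aestronglyMeasurable.mul hf.1
  · exact ae_of_all _ fun p => by rw [norm_mul, norm_exp_I_mul_ofReal, one_mul]
  · have : Continuous fun z => pairInner z p :=
      continuous_pairInner.comp (continuous_id.prodMk continuous_const)
    fun_prop

/-- A function of the sides of a triangle damped by a Gaussian in two of them. -/
noncomputable def dampedSides (b : ℝ) (C : ℝ → ℝ → ℝ → ℝ) (r₁ r₂ r₃ : ℝ) : ℝ :=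
  Real.exp (-b * r₂ ^ 2) * Real.exp (-b * r₃ ^ 2) * C r₁ r₂ r₃

lemma onPairs_dampedSides (b : ℝ) (C : ℝ → ℝ → ℝ → ℝ) (p : Plane × Plane) :
    onPairs (dampedSides b C) p = gaussWeight b p * onPairs C p := rfl

/-- The inverse integral carries the conjugate exponential, that is the forward one at the opposite
pair of vectors. Negating both side parameters describes that pair and leaves the kernel alone. -/
lemma besselKernel_neg_sides (q t : ℝ × ℝ × ℝ) :
    besselKernel q (-t.1, -t.2.1, t.2.2) = besselKernel q t := by
  simp only [besselKernel, thirdSide]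
  ring_nf

lemma neg_trianglePoint (t : ℝ × ℝ × ℝ) (β : ℝ) :
    -trianglePoint (t, β) = trianglePoint ((-t.1, -t.2.1, t.2.2), β) := by
  refine Prod.ext ?_ ?_ <;> exact plane_ext (by simp [trianglePoint]) (by simp [trianglePoint])

section Inversion

variable {C S : ℝ → ℝ → ℝ → ℝ} (hS : Integrable (onPairs S))
  (hCS : ∀ z, pairFourier (fun p => (onPairs S p : ℂ)) z = onPairs C z)

include hS hCS

theorem forward_transform {t : ℝ × ℝ × ℝ} (h1 : 0 ≤ t.1) (h2 : 0 ≤ t.2.1) :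
    IntegrableOn (fun q => besselKernel q t * onTriangles S q * (q.1 * q.2.1)) sidesAngle ∧
    onTriangles C t =
      2 * Real.pi * ∫ q in sidesAngle, besselKernel q t * onTriangles S q * (q.1 * q.2.1) := by
  obtain ⟨hi, he⟩ := integral_exp_pairInner_onPairs hS t 0
  refine ⟨hi, ?_⟩
  have h := hCS (trianglePoint (t, 0))
  rw [onPairs_trianglePoint C h1 h2, pairFourier, he] at h
  exact (Complex.ofReal_injective h).symm

/-- As the transform of an integrable function, `C` is bounded and continuous on pairs, so a
Gaussian factor makes it integrable. -/
lemma integrable_onPairs_dampedSides {b : ℝ} (hb : 0 < b) :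
    Integrable (onPairs (dampedSides b C)) := by
  have hre (z) : onPairs C z = (pairFourier (fun p => (onPairs S p : ℂ)) z).re := by
    rw [hCS, Complex.ofReal_re]
  have hc : Continuous (onPairs C) := by
    have := Complex.continuous_re.comp
      (continuous_pairFourier (f := fun p => (onPairs S p : ℂ)) hS.ofReal)
    exact this.congr fun z => (hre z).symm
  have h := (integrable_gaussWeight hb).bdd_mul
    (c := ∫ p, ‖(onPairs S p : ℂ)‖) hc.aestronglyMeasurable (ae_of_all _ fun z => by
      rw [hre]
      exact (Complex.abs_re_le_norm _).trans (norm_pairFourier_le _ _))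
  refine h.congr (ae_of_all _ fun p => ?_)
  rw [onPairs_dampedSides, mul_comm]

/-- The forward formula is applied to the damped `C`; its factor `2π` reduces `(2π)⁻⁴` to `(2π)⁻³`.
-/
lemma gaussInverse_eq {b : ℝ} (hb : 0 < b) (q : ℝ × ℝ × ℝ) (β : ℝ) :
    gaussInverse (pairFourier (fun p => (onPairs S p : ℂ))) b (trianglePoint (q, β)) =
      ((1 / (2 * Real.pi) ^ 3 * ∫ t in sidesAngle,
        Real.exp (-b * t.1 ^ 2) * Real.exp (-b * t.2.1 ^ 2) *
          (besselKernel q t * onTriangles C t * (t.1 * t.2.1)) : ℝ) : ℂ) := by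
  have h := (integral_exp_pairInner_onPairs (integrable_onPairs_dampedSides hS hCS hb)
    (-q.1, -q.2.1, q.2.2) β).2
  have hE : (fun z => Complex.exp (-(Complex.I * (pairInner z (trianglePoint (q, β)) : ℂ))) *
      ((gaussWeight b z : ℂ) * pairFourier (fun p => (onPairs S p : ℂ)) z)) =
      fun z => Complex.exp (Complex.I *
        (pairInner (trianglePoint ((-q.1, -q.2.1, q.2.2), β)) z : ℂ)) *
        (onPairs (dampedSides b C) z : ℂ) := by
    funext z
    have : pairInner (-trianglePoint (q, β)) z = -pairInner z (trianglePoint (q, β)) := by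
      simp only [pairInner, Prod.fst_neg, Prod.snd_neg, inner_neg_left]
      rw [real_inner_comm z.1, real_inner_comm z.2]
      ring
    rw [← neg_trianglePoint, this, hCS, onPairs_dampedSides]
    push_cast
    ring_nf
  rw [gaussInverse, hE, h]
  have hK : (fun t => besselKernel t (-q.1, -q.2.1, q.2.2) * onTriangles (dampedSides b C) t *
      (t.1 * t.2.1)) = fun t => Real.exp (-b * t.1 ^ 2) * Real.exp (-b * t.2.1 ^ 2) *
          (besselKernel q t * onTriangles C t * (t.1 * t.2.1)) := by
    funext t
    rw [besselKernel_neg_sides, besselKernel_comm, onTriangles, dampedSides, onTriangles]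
    ring
  rw [hK]
  have hp : (Real.pi : ℂ) ≠ 0 := by exact_mod_cast Real.pi_ne_zero
  push_cast
  field_simp

/-- Absolute existence of the inverse integral enters here: the undamped integrand dominates all the
damped ones. -/
lemma tendsto_gaussMean_trianglePoint {q : ℝ × ℝ × ℝ} (β : ℝ)
    (hq : IntegrableOn (fun t => besselKernel q t * onTriangles C t * (t.1 * t.2.1)) sidesAngle) :
    Tendsto (fun c => gaussMean (fun p => (onPairs S p : ℂ)) c (trianglePoint (q, β))) atTop
      (𝓝 ((1 / (2 * Real.pi) ^ 3 * ∫ t in sidesAngle,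
        besselKernel q t * onTriangles C t * (t.1 * t.2.1) : ℝ) : ℂ)) := by
  set H : ℝ × ℝ × ℝ → ℝ := fun t => besselKernel q t * onTriangles C t * (t.1 * t.2.1)
  have hlim : Tendsto (fun c : ℝ => ∫ t in sidesAngle,
      Real.exp (-(1 / (4 * c ^ 2)) * t.1 ^ 2) * Real.exp (-(1 / (4 * c ^ 2)) * t.2.1 ^ 2) * H t)
      atTop (𝓝 (∫ t in sidesAngle, H t)) := by
    refine tendsto_integral_filter_of_dominated_convergence (fun t => ‖H t‖)
      (Eventually.of_forall fun c => ?_) (Eventually.of_forall fun c => ae_of_all _ fun t => ?_)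
      hq.norm (ae_of_all _ fun t => ?_)
    · exact (Continuous.aestronglyMeasurable (by fun_prop)).mul hq.1
    · rw [norm_mul, norm_mul, Real.norm_of_nonneg (Real.exp_pos _).le,
        Real.norm_of_nonneg (Real.exp_pos _).le]
      refine mul_le_of_le_one_left (norm_nonneg _) (mul_le_one₀ ?_ (Real.exp_pos _).le ?_) <;>
      · rw [Real.exp_le_one_iff, neg_mul, neg_nonpos]; positivity
    · have h0 : Tendsto (fun c : ℝ => -(1 / (4 * c ^ 2))) atTop (𝓝 0) := by
        have h1 : Tendsto (fun c : ℝ => 4 * c ^ 2) atTop atTop :=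
          (tendsto_pow_atTop two_ne_zero).const_mul_atTop (by norm_num)
        simpa using h1.inv_tendsto_atTop.neg
      have h1 (x : ℝ) : Tendsto (fun c : ℝ => Real.exp (-(1 / (4 * c ^ 2)) * x)) atTop (𝓝 1) := by
        have := (Real.continuous_exp.tendsto _).comp (h0.mul_const x)
        simpa [Function.comp_def] using this
      simpa using ((h1 (t.1 ^ 2)).mul (h1 (t.2.1 ^ 2))).mul_const (H t)
  have h2 := (Complex.continuous_ofReal.tendsto _).comp
    (hlim.const_mul (1 / (2 * Real.pi) ^ 3))
  refine h2.congr' ?_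
  filter_upwards [eventually_gt_atTop 0] with c hc
  rw [← gaussInverse_pairFourier (f := fun p => (onPairs S p : ℂ)) hS.ofReal hc,
    gaussInverse_eq hS hCS (by positivity)]
  rfl

/-- For almost every triangle, almost every rotated copy is a point of convergence. One copy is
enough, since `S` and the limit do not depend on the rotation. -/
theorem inverse_transform_ae :
    ∀ᵐ q ∂(volume.restrict sidesAngle),
      IntegrableOn (fun t => besselKernel q t * onTriangles C t * (t.1 * t.2.1)) sidesAngle →
      onTriangles S q = 1 / (2 * Real.pi) ^ 3 *
        ∫ t in sidesAngle, besselKernel q t * onTriangles C t * (t.1 * t.2.1) := by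
  obtain ⟨s, -, hs, hlim⟩ := exists_seq_tendsto_ae_gaussMean
    (f := fun p => (onPairs S p : ℂ)) hS.ofReal
  have h := Measure.ae_ae_of_ae_prod
    (measurePreserving_trianglePoint.quasiMeasurePreserving.ae hlim)
  refine ae_restrict_sidesAngle_of_ae_sidesMeasure ?_
  filter_upwards [h, ae_sidesMeasure_pos] with q hq hpos hint
  have : NeZero angleMeasure := ⟨angleMeasure_ne_zero⟩
  obtain ⟨β, hβ⟩ := hq.exists
  have := tendsto_nhds_unique hβ ((tendsto_gaussMean_trianglePoint hS hCS β hint).comp hs)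
  rw [onPairs_trianglePoint S hpos.1.le hpos.2.le] at this
  exact Complex.ofReal_injective this

theorem inverse_transform_of_continuous (hcont : Continuous (onPairs S)) {q : ℝ × ℝ × ℝ}
    (h1 : 0 ≤ q.1) (h2 : 0 ≤ q.2.1)
    (hint : IntegrableOn (fun t => besselKernel q t * onTriangles C t * (t.1 * t.2.1)) sidesAngle) :
    onTriangles S q = 1 / (2 * Real.pi) ^ 3 *
      ∫ t in sidesAngle, besselKernel q t * onTriangles C t * (t.1 * t.2.1) := by
  have h := tendsto_gaussMean_of_continuousAt (f := fun p => (onPairs S p : ℂ)) hS.ofReal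
    (Complex.continuous_ofReal.comp hcont).continuousAt (q := trianglePoint (q, 0))
  have := tendsto_nhds_unique h (tendsto_gaussMean_trianglePoint hS hCS 0 hint)
  rw [onPairs_trianglePoint S h1 h2] at this
  exact Complex.ofReal_injective this

end Inversion

lemma thirdSide_norm_angle (x y : Plane) :
    thirdSide ‖x‖ ‖y‖ (InnerProductGeometry.angle x y) = ‖x - y‖ := by
  rw [thirdSide, ← Real.sqrt_sq (norm_nonneg (x - y)), norm_sub_sq_real,
    ← InnerProductGeometry.cos_angle_mul_norm_mul_norm]
  ring_nf

/-- The angle between two vectors is discontinuous where one vanishes. By compactness of `[0, π]`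
the angles converge along a subsequence, and the limit angle yields the right third side by
continuity, which is all that the value depends on. -/
theorem continuous_onPairs {S : ℝ → ℝ → ℝ → ℝ}
    (hS : ContinuousOn (onTriangles S) closedSidesAngle) : Continuous (onPairs S) := by
  rw [continuous_iff_seqContinuous]
  intro u p hu
  set η : ℕ → ℝ := fun n => InnerProductGeometry.angle (u n).1 (u n).2
  have hη (n) : η n ∈ Set.Icc 0 Real.pi :=
    ⟨InnerProductGeometry.angle_nonneg _ _, InnerProductGeometry.angle_le_pi _ _⟩
  have heq (n) : onPairs S (u n) = onTriangles S (‖(u n).1‖, ‖(u n).2‖, η n) := by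
    simp only [onPairs, onTriangles, η, thirdSide_norm_angle]
  refine tendsto_of_subseq_tendsto fun ns hns => ?_
  obtain ⟨θ, hθ, ms, hmono, hms⟩ := isCompact_Icc.tendsto_subseq (fun n => hη (ns n))
  refine ⟨ms, ?_⟩
  have hv : Tendsto (fun n => u (ns (ms n))) atTop (𝓝 p) :=
    hu.comp (hns.comp hmono.tendsto_atTop)
  have hv1 := (continuous_fst.tendsto p).comp hv
  have hv2 := (continuous_snd.tendsto p).comp hv
  have hlim : Tendsto (fun n => (‖(u (ns (ms n))).1‖, ‖(u (ns (ms n))).2‖, η (ns (ms n)))) atTop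
      (𝓝 (‖p.1‖, ‖p.2‖, θ)) := hv1.norm.prodMk_nhds (hv2.norm.prodMk_nhds hms)
  have hmem (a b : Plane) {γ : ℝ} (h : γ ∈ Set.Icc 0 Real.pi) :
      (‖a‖, ‖b‖, γ) ∈ closedSidesAngle := ⟨norm_nonneg _, norm_nonneg _, h⟩
  have hT := ((hS _ (hmem p.1 p.2 hθ)).tendsto).comp
    (tendsto_nhdsWithin_iff.2 ⟨hlim, Eventually.of_forall fun n => hmem _ _ (hη _)⟩)
  have hside : thirdSide ‖p.1‖ ‖p.2‖ θ = ‖p.1 - p.2‖ := by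
    have hc : Continuous fun q : ℝ × ℝ × ℝ => thirdSide q.1 q.2.1 q.2.2 :=
      continuous_thirdSide (by fun_prop) (by fun_prop) (by fun_prop)
    have h1 := (hc.tendsto _).comp hlim
    refine tendsto_nhds_unique h1 (((hv1.sub hv2).norm).congr fun n => ?_)
    exact (thirdSide_norm_angle _ _).symm
  have hval : onTriangles S (‖p.1‖, ‖p.2‖, θ) = onPairs S p := by
    simp only [onTriangles, onPairs, hside]
  rw [hval] at hT
  exact hT.congr fun n => (heq _).symm

/-! ### The two forms of the transform pair and the main theorem -/

theorem areTransformPair_besselKernel {C S : ℝ → ℝ → ℝ → ℝ} (hS : Integrable (onPairs S))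
    (hCS : ∀ z, pairFourier (fun p => (onPairs S p : ℂ)) z = onPairs C z) :
    AreTransformPair besselKernel (2 * Real.pi) (1 / (2 * Real.pi) ^ 3) C S :=
  ⟨fun r₂ r₃ φ h₂ h₃ => forward_transform hS hCS (t := (r₂, r₃, φ)) h₂ h₃,
    inverse_transform_ae hS hCS,
    fun hc _ hq => inverse_transform_of_continuous hS hCS (continuous_onPairs hc) hq.1 hq.2.1⟩

theorem AreTransformPair.seriesKernel {C S : ℝ → ℝ → ℝ → ℝ} {a b : ℝ}
    (h : AreTransformPair besselKernel a b C S) :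
    AreTransformPair seriesKernel (2 * a) (2 * b) C S := by
  have hfun (q t : ℝ × ℝ × ℝ) (x y : ℝ) :
      _root_.seriesKernel q t * x * y = 1 / 2 * (besselKernel q t * x * y) := by
    rw [seriesKernel_eq]; ring
  have hint (F : ℝ × ℝ × ℝ → ℝ) : IntegrableOn (fun q => 1 / 2 * F q) sidesAngle ↔
      IntegrableOn F sidesAngle := integrable_const_mul_iff (by norm_num) F
  have hval (c I : ℝ) : 2 * c * (1 / 2 * I) = c * I := by ring
  simp only [AreTransformPair, hfun, hint, integral_const_mul, hval]
  exact h

theorem theorem1 {Ω : Type*} [MeasurableSpace Ω] (P : Measure Ω) [IsProbabilityMeasure P]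
    (X : Plane → Ω → ℝ) (hX : IsHomogeneousIsotropicField P X)
    (hmirror : ∀ x₁ x₂ x₃ : Plane,
      cum3 P (X (planeMirror x₁)) (X (planeMirror x₂)) (X (planeMirror x₃)) = cum3 P (X x₁) (X x₂) (X x₃)) :
    (∃ C : ℝ → ℝ → ℝ → ℝ, IsTriangleCovariance P X C) ∧
    (∀ S : Plane → Plane → Plane → ℂ, IsBispectralDensity P X S →
      ∃ S₃ : ℝ → ℝ → ℝ → ℝ, ∀ᵐ p : Plane × Plane,
        S (-p.1 - p.2) p.1 p.2 = (S₃ ‖-p.1 - p.2‖ ‖p.1‖ ‖p.2‖ : ℂ)) ∧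
    (∀ C S₃ : ℝ → ℝ → ℝ → ℝ, IsTriangleCovariance P X C →
      IsBispectralDensity P X (fun ω₁ ω₂ ω₃ => (S₃ ‖ω₁‖ ‖ω₂‖ ‖ω₃‖ : ℂ)) →
      AreTransformPair besselKernel (2 * Real.pi) (1 / (2 * Real.pi) ^ 3) C S₃ ∧
      AreTransformPair seriesKernel (4 * Real.pi) (1 / (4 * Real.pi ^ 3)) C S₃) ∧
    (∀ q t : ℝ × ℝ × ℝ, Summable (seriesTerm q t) ∧
      seriesKernel q t = 1 / 2 * besselKernel q t) := by
  refine ⟨exists_isTriangleCovariance hX hmirror, fun S hS => hS.exists_ae_eq hX hmirror,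
    fun C S₃ hC hS => ?_, fun q t => ⟨summable_seriesTerm q t, seriesKernel_eq q t⟩⟩
  obtain ⟨hI, hF⟩ := hS.pairFourier_eq
  have hpair (p : Plane × Plane) : S₃ ‖p.2 - p.1‖ ‖p.1‖ ‖-p.2‖ = onPairs S₃ p := by
    rw [norm_neg, norm_sub_rev, onPairs]
  simp only [hpair, hC.pairCovariance_eq] at hI hF
  have h := areTransformPair_besselKernel (by simpa using hI.re) hF
  refine ⟨h, ?_⟩
  convert! h.seriesKernel using 1
  · ring
  · have := Real.pi_ne_zero
    field_simp
    norm_num
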